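/- Let $G$ be an infinite group with a finite generating set $S$, and let $X$ be the Cayley graph of $G$ with respect to $S$, regarded as a geodesic metric space in which every edge has length $1$. Suppose that $X$ is $\delta$-hyperbolic, i.e. each side of every geodesic triangle in $X$ lies in the $\delta$-neighbourhood of the union of the two other sides. Let $\mathcal L$ be the language of all words with letters in $S\cup S^{-1}$ all of whose subwords (blocks of consecutive letters) of length at most $10\delta$ are geodesic in $X$. Suppose that for every pair of words $w_1,w_3\in\mathcal L$ there is a word $w_2\in\mathcal L$ such that the concatenation $w_1w_2w_3$ also belongs to $\mathcal L$. Then there exist constants $D,R$ such that for every $g\in G$ with $d_X(1_G,g)\geqslant 10\delta$ there is an element $\tilde g\in G$ with the following properties: (1) $d_X(g,\tilde g)\leqslant D$; (2) $\tilde g$ acts loxodromically on $X$, i.e. $\lim_{n\to\infty}\frac1n d_X(1_G,\tilde g^{\,n})$ exists and is positive; in particular $\tilde g$ has infinite order; (3) $\tilde g$ has an axis in $X$, i.e. a bi-infinite geodesic connecting the two points $\lim_{n\to\infty}\tilde g^{\,-n}$ and $\lim_{n\to\infty}\tilde g^{\,n}$ of the Gromov boundary $\partial X$, and every axis of $\tilde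 g$ passes within distance $R$ of the vertex $1_G$. -/

import Mathlib

open Filter Topology

noncomputable section

namespace CayleyHyp

/-! ### The geometric realization of a connected graph -/

open Classical in
/-- Barycentric coordinates of the point at distance `s` from `u` on the edge `{u, v}`. -/
def edgeCoord {V : Type*} (u v : V) (s : ℝ) : V → ℝ :=
  fun w => (1 - s) * (if w = u then 1 else 0) + s * (if w = v then 1 else 0)

/-- The geometric realization of a connected simple graph: its points are the vertices and the
points of the closed edges, given by barycentric coordinates. It carries the length metric in
which every edge has length `1` (see the instance below). -/
structure Realization {V : Type*} (Γ : SimpleGraph V) (hΓ : Γ.Connected) where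
  coord : V → ℝ
  exists_edge : ∃ u v : V, (u = v ∨ Γ.Adj u v) ∧ ∃ s ∈ Set.Icc (0 : ℝ) 1, coord = edgeCoord u v s

namespace Realization

variable {V : Type*} {Γ : SimpleGraph V} {hΓ : Γ.Connected}

theorem coord_injective {x y : Realization Γ hΓ} (h : x.coord = y.coord) : x = y := by
  cases x; cases y; cases h; rfl

/-- A vertex, as a point of the realization. -/
def vertex (u : V) : Realization Γ hΓ :=
  ⟨edgeCoord u u 0, u, u, Or.inl rfl, 0, by simp, rfl⟩

/-- `IsChain x y ℓ`: the points `x` and `y` can be joined by finitely many consecutive straight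
paths, each contained in one edge, of total length `ℓ`. -/
inductive IsChain : Realization Γ hΓ → Realization Γ hΓ → ℝ → Prop
  | nil (x : Realization Γ hΓ) : IsChain x x 0
  | cons (u v : V) (huv : Γ.Adj u v) (s t : ℝ) (hs : s ∈ Set.Icc (0 : ℝ) 1)
      (ht : t ∈ Set.Icc (0 : ℝ) 1) (x y z : Realization Γ hΓ)
      (hx : x.coord = edgeCoord u v s) (hy : y.coord = edgeCoord u v t) (ℓ : ℝ)
      (hyz : IsChain y z ℓ) : IsChain x z (|s - t| + ℓ)

theorem IsChain.trans {x y z : Realization Γ hΓ} {a b : ℝ} (h₁ : IsChain x y a)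
    (h₂ : IsChain y z b) : IsChain x z (a + b) := by
  induction h₁ with
  | nil => simpa using h₂
  | cons u v huv s t hs ht x y _ hx hy ℓ _ ih =>
    rw [add_assoc]
    exact .cons u v huv s t hs ht x y _ hx hy _ (ih h₂)

theorem IsChain.symm {x y : Realization Γ hΓ} {a : ℝ} (h : IsChain x y a) : IsChain y x a := by
  induction h with
  | nil => exact .nil _
  | cons u v huv s t hs ht x y _ hx hy ℓ _ ih =>
    have h := ih.trans (.cons u v huv t s ht hs y x x hy hx 0 (.nil x))
    rwa [add_zero, add_comm, abs_sub_comm] at h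

theorem IsChain.nonneg {x y : Realization Γ hΓ} {a : ℝ} (h : IsChain x y a) : 0 ≤ a := by
  induction h with
  | nil => exact le_rfl
  | cons u v huv s t hs ht x y _ hx hy ℓ _ ih => positivity

theorem abs_edgeCoord_sub_le {u v : V} (h : u ≠ v) (s t : ℝ) (w : V) :
    |edgeCoord u v s w - edgeCoord u v t w| ≤ |s - t| := by
  by_cases hu : w = u
  · subst hu
    rw [abs_sub_comm s t]
    refine le_of_eq (congrArg _ ?_)
    simp only [edgeCoord, if_true, if_neg h]
    ring
  · by_cases hv : w = v
    · refine le_of_eq (congrArg _ ?_)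
      simp only [edgeCoord, if_pos hv, if_neg hu]
      ring
    · simp [edgeCoord, hu, hv]

theorem IsChain.abs_coord_le {x y : Realization Γ hΓ} {a : ℝ} (h : IsChain x y a) (w : V) :
    |x.coord w - y.coord w| ≤ a := by
  induction h with
  | nil => simp
  | cons u v huv s t hs ht x y z hx hy ℓ _ ih =>
    have h₁ := abs_edgeCoord_sub_le huv.ne s t w
    rw [← hx, ← hy] at h₁
    exact (abs_sub_le _ (y.coord w) _).trans (add_le_add h₁ ih)

theorem exists_chain_vertex_vertex {u v : V} (p : Γ.Walk u v) :
    ∃ a, IsChain (vertex u : Realization Γ hΓ) (vertex v) a := by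
  induction p with
  | nil => exact ⟨0, .nil _⟩
  | @cons u v w huv _ ih =>
    obtain ⟨a, ha⟩ := ih
    refine ⟨_, .cons u v huv 0 1 (by simp) (by simp) _ (vertex v) _ ?_ ?_ a ha⟩ <;>
      · funext x; simp [vertex, edgeCoord]

theorem exists_chain_to_vertex (x : Realization Γ hΓ) : ∃ u a, IsChain x (vertex u) a := by
  obtain ⟨u, v, h, s, hs, hx⟩ := x.exists_edge
  refine ⟨u, ?_⟩
  rcases h with rfl | h
  · refine ⟨0, ?_⟩
    have : x = vertex u := coord_injective (by
      rw [hx]; funext w; simp only [vertex, edgeCoord]; ring)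
    rw [this]; exact .nil _
  · refine ⟨_, .cons u v h s 0 hs (by simp) _ (vertex u) _ hx ?_ 0 (.nil _)⟩
    funext w; simp [vertex, edgeCoord]

theorem exists_chain (x y : Realization Γ hΓ) : ∃ a, IsChain x y a := by
  obtain ⟨u, a, ha⟩ := exists_chain_to_vertex x
  obtain ⟨v, b, hb⟩ := exists_chain_to_vertex y
  obtain ⟨p⟩ := hΓ.preconnected u v
  obtain ⟨c, hc⟩ := exists_chain_vertex_vertex (hΓ := hΓ) p
  exact ⟨_, (ha.trans hc).trans hb.symm⟩

theorem bddBelow_chain (x y : Realization Γ hΓ) : BddBelow {a | IsChain x y a} :=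
  ⟨0, fun _ ha => IsChain.nonneg ha⟩

/-- The length metric: the distance is the infimum of the lengths of the paths. -/
instance : MetricSpace (Realization Γ hΓ) where
  dist x y := sInf {a | IsChain x y a}
  dist_self x := le_antisymm (csInf_le (bddBelow_chain x x) (.nil x))
    (le_csInf (exists_chain x x) fun _ ha => IsChain.nonneg ha)
  dist_comm x y := congrArg sInf (Set.ext fun _ => ⟨IsChain.symm, IsChain.symm⟩)
  dist_triangle x y z := by
    refine le_of_forall_pos_le_add fun ε hε => ?_
    obtain ⟨a, ha, ha'⟩ := exists_lt_of_csInf_lt (exists_chain x y)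
      (lt_add_of_pos_right (sInf {a | IsChain x y a}) (half_pos hε))
    obtain ⟨b, hb, hb'⟩ := exists_lt_of_csInf_lt (exists_chain y z)
      (lt_add_of_pos_right (sInf {a | IsChain y z a}) (half_pos hε))
    have := csInf_le (bddBelow_chain x z) (IsChain.trans ha hb)
    linarith
  eq_of_dist_eq_zero {x y} h := by
    refine coord_injective (funext fun w => ?_)
    have h₁ : |x.coord w - y.coord w| ≤ sInf {a | IsChain x y a} :=
      le_csInf (exists_chain x y) fun _ ha => IsChain.abs_coord_le ha w
    have h₂ : |x.coord w - y.coord w| ≤ 0 := h₁.trans (le_of_eq h)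
    exact sub_eq_zero.mp (abs_nonpos_iff.mp h₂)

end Realization

/-! ### Geodesics, hyperbolicity and loxodromic isometries -/

section Metric

variable {X : Type*} [MetricSpace X]

/-- The set `σ` is a geodesic segment with end points `x` and `y`. -/
def IsGeodesicSegment (x y : X) (σ : Set X) : Prop :=
  ∃ c : ℝ → X, c 0 = x ∧ c (dist x y) = y ∧
    (∀ s ∈ Set.Icc 0 (dist x y), ∀ t ∈ Set.Icc 0 (dist x y), dist (c s) (c t) = |s - t|) ∧
    σ = c '' Set.Icc 0 (dist x y)

variable (X) in
/-- `X` is a `δ`-hyperbolic (geodesic) space: any two points are joined by a geodesic segment, and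
each side of a geodesic triangle lies in the `δ`-neighbourhood of the two other sides. -/
def IsHyperbolic (δ : ℝ) : Prop :=
  (∀ x y : X, ∃ σ, IsGeodesicSegment x y σ) ∧
  ∀ (x y z : X) (a b c : Set X), IsGeodesicSegment x y a → IsGeodesicSegment y z b →
    IsGeodesicSegment z x c → ∀ p ∈ a, ∃ q ∈ b ∪ c, dist p q ≤ δ

/-- The Gromov product `(x | y)_p`. -/
def gromovProduct (p x y : X) : ℝ := (dist p x + dist p y - dist x y) / 2

variable {G : Type*} [Group G] [MulAction G X]

/-- The element `g` acts loxodromically: its translation length `lim d(p, gⁿ p) / n`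
exists and is positive (`p` is a base point). -/
def ActsLoxodromically (p : X) (g : G) : Prop :=
  ∃ τ : ℝ, 0 < τ ∧ Tendsto (fun n : ℕ => dist p (g ^ n • p) / n) atTop (𝓝 τ)

/-- The bi-infinite geodesic `γ` is an axis of `g`: as `t → ∞`, the points `γ t` and `γ (-t)`
converge in the Gromov boundary to the limits of `gⁿ p` and of `g⁻ⁿ p` as `n → ∞`. -/
def IsAxis (p : X) (g : G) (γ : ℝ → X) : Prop :=
  Isometry γ ∧
  Tendsto (fun q : ℝ × ℕ => gromovProduct p (γ q.1) (g ^ q.2 • p)) (atTop ×ˢ atTop) atTop ∧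
  Tendsto (fun q : ℝ × ℕ => gromovProduct p (γ (-q.1)) (g⁻¹ ^ q.2 • p)) (atTop ×ˢ atTop) atTop

end Metric

/-! ### The Cayley graph -/

section Cayley

variable {G : Type*} [Group G]

theorem cayley_connected {S : Set G} (hS : Subgroup.closure S = ⊤) :
    (SimpleGraph.mulCayley S).Connected := by
  have key : ∀ g : G, ∀ u, (SimpleGraph.mulCayley S).Reachable u (u * g) := by
    intro g
    have hg : g ∈ Subgroup.closure S := hS ▸ Subgroup.mem_top g
    induction hg using Subgroup.closure_induction with
    | mem x hx =>
      intro u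
      by_cases h : u = u * x
      · rw [← h]
      · exact ((SimpleGraph.mulCayley_adj S _ _).2 ⟨h, Or.inl (by simpa using hx)⟩).reachable
    | one => intro u; simp
    | mul x y _ _ hx hy =>
      intro u
      rw [← mul_assoc]
      exact (hx u).trans (hy (u * x))
    | inv x _ hx =>
      intro u
      simpa using (hx (u * x⁻¹)).symm
  have : Nonempty G := ⟨1⟩
  exact ⟨fun u v => by simpa using key (u⁻¹ * v) u⟩

/-- The Cayley graph of `G` with respect to the generating set `S`, as a metric space. -/
abbrev CayleySpace (S : Set G) (hS : Subgroup.closure S = ⊤) : Type _ :=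
  Realization (SimpleGraph.mulCayley S) (cayley_connected hS)

theorem edgeCoord_mul (g u v : G) (s : ℝ) (w : G) :
    edgeCoord u v s (g⁻¹ * w) = edgeCoord (g * u) (g * v) s w := by
  have h : ∀ a : G, g⁻¹ * w = a ↔ w = g * a := fun a => inv_mul_eq_iff_eq_mul
  have e : ∀ a : G, (@ite ℝ (g⁻¹ * w = a) (Classical.propDecidable _) 1 0) =
      @ite ℝ (w = g * a) (Classical.propDecidable _) 1 0 := fun a =>
    @if_congr _ _ _ (Classical.propDecidable _) (Classical.propDecidable _) _ _ _ _ (h a) rfl rfl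
  unfold edgeCoord
  rw [e u, e v]

/-- The left action of `G` on its Cayley graph; on vertices it is the left multiplication. -/
instance (S : Set G) (hS : Subgroup.closure S = ⊤) : MulAction G (CayleySpace S hS) where
  smul g x := ⟨fun w => x.coord (g⁻¹ * w), by
    obtain ⟨u, v, h, s, hs, hx⟩ := x.exists_edge
    refine ⟨g * u, g * v, ?_, s, hs, ?_⟩
    · rcases h with rfl | h
      · exact Or.inl rfl
      · exact Or.inr (SimpleGraph.mulCayley_adj_mul_iff_right.2 h)
    · funext w
      rw [hx, edgeCoord_mul]⟩
  one_smul x := Realization.coord_injective (funext fun w => by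
    change x.coord (1⁻¹ * w) = x.coord w
    simp)
  mul_smul g h x := Realization.coord_injective (funext fun w => by
    change x.coord ((g * h)⁻¹ * w) = x.coord (h⁻¹ * (g⁻¹ * w))
    simp [mul_assoc])

/-- The vertex of the Cayley graph given by the group element `g`. -/
def cayleyVertex (S : Set G) (hS : Subgroup.closure S = ⊤) (g : G) : CayleySpace S hS :=
  Realization.vertex g

/-- A word with letters in `S ∪ S⁻¹` is geodesic if the path that it labels in the Cayley graph,
which has as many edges as the word has letters, is as short as the distance of its end points. -/
def IsGeodesicWord (S : Set G) (hS : Subgroup.closure S = ⊤) (w : List G) : Prop :=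
  dist (cayleyVertex S hS 1) (cayleyVertex S hS w.prod) = w.length

/-- The language of the `k`-local geodesics: the words with letters in `S ∪ S⁻¹` in which no
non-geodesic word of length at most `k` occurs as a subword (of consecutive letters). -/
def localGeodesics (S : Set G) (hS : Subgroup.closure S = ⊤) (k : ℝ) : Language G :=
  {w | (∀ a ∈ w, a ∈ S ∨ a⁻¹ ∈ S) ∧
    ∀ v : List G, v <:+: w → (v.length : ℝ) ≤ k → IsGeodesicWord S hS v}

/-- Any two words of the language `L` can be joined by a word of `L` to form a word of `L`. -/
def ConcatenationHypothesis (L : Language G) : Prop :=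
  ∀ w₁ ∈ L, ∀ w₃ ∈ L, ∃ w₂ ∈ L, w₁ ++ w₂ ++ w₃ ∈ L

end Cayley

end CayleyHyp

end

/-!
A geodesic word `w` for `g` is closed up to a cyclic word `w f` by a word `f` of bounded length, in
such a way that all short subwords of `… w f w f …` are geodesic. The word `f` only has to depend on
the last few and the first few letters of `w`, so there are finitely many choices. The periodic path
so labelled is a local geodesic through `1` on which `g' = w f` acts as a shift. In a hyperbolic
graph a local geodesic stays close to every geodesic between two of its points: the point farthest
from the geodesic is in the middle of one side of a quadrilateral, and it is too far away from the
two sides that lead to the geodesic, hence close to the geodesic, which is the fourth side. Counting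
vertices near the geodesic, the path is a quasi-geodesic, hence `g'` is loxodromic. The geodesics
between `g' ^ (-m)` and `g' ^ m` pass close to `1`, have an axis as a limit, and stay close to every
axis, so that every axis passes close to `1`.

The language only controls single letters if `10 * δ < 2`. In that case the Cayley graph has no
triangles, and `f` can be taken to be empty or a single letter of `w`.
-/

noncomputable section

namespace CayleyHyp

/-! ### Geodesics in graphs -/

section Graph

variable {V : Type*} {Γ : SimpleGraph V}

/-- The sequence of vertices `p` is geodesic along the set of times `s`. -/
def IsGeodesicOn (Γ : SimpleGraph V) (p : ℤ → V) (s : Set ℤ) : Prop :=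
  ∀ i ∈ s, ∀ j ∈ s, Γ.dist (p i) (p j) = (j - i).natAbs

/-- The vertex `v` lies on some geodesic from `x` to `y`. -/
def IsBetween (Γ : SimpleGraph V) (x v y : V) : Prop :=
  Γ.dist x v + Γ.dist v y = Γ.dist x y

theorem IsGeodesicOn.mono {p : ℤ → V} {s t : Set ℤ} (hp : IsGeodesicOn Γ p t) (hst : s ⊆ t) :
    IsGeodesicOn Γ p s :=
  fun i hi j hj => hp i (hst hi) j (hst hj)

theorem IsGeodesicOn.comp_neg {p : ℤ → V} {s : Set ℤ} (hp : IsGeodesicOn Γ p s) :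
    IsGeodesicOn Γ (fun i => p (-i)) (-s) :=
  fun i hi j hj => by rw [hp (-i) hi (-j) hj]; omega

theorem IsGeodesicOn.comp_add_const {p : ℤ → V} {s : Set ℤ} (hp : IsGeodesicOn Γ p s) (a : ℤ) :
    IsGeodesicOn Γ (fun i => p (i + a)) ((· + a) ⁻¹' s) :=
  fun i hi j hj => by rw [hp (i + a) hi (j + a) hj]; omega

theorem IsGeodesicOn.adj {p : ℤ → V} {s : Set ℤ} (hp : IsGeodesicOn Γ p s) {i : ℤ} (hi : i ∈ s)
    (hi' : i + 1 ∈ s) : Γ.Adj (p i) (p (i + 1)) := by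
  rw [← SimpleGraph.dist_eq_one_iff_adj, hp i hi _ hi']
  omega

theorem isBetween_comm {x v y : V} : IsBetween Γ x v y ↔ IsBetween Γ y v x := by
  have hxv := Γ.dist_comm (u := x) (v := v)
  have hvy := Γ.dist_comm (u := v) (v := y)
  have hxy := Γ.dist_comm (u := x) (v := y)
  unfold IsBetween
  omega

theorem IsGeodesicOn.isBetween {p : ℤ → V} {s : Set ℤ} (hp : IsGeodesicOn Γ p s) {i j k : ℤ}
    (hi : i ∈ s) (hj : j ∈ s) (hk : k ∈ s) (hjik : j ∈ Set.uIcc i k) :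
    IsBetween Γ (p i) (p j) (p k) := by
  rw [Set.mem_uIcc] at hjik
  rw [IsBetween, hp i hi j hj, hp j hj k hk, hp i hi k hk]
  omega

theorem isGeodesicOn_getVert {x y : V} {w : Γ.Walk x y} (hw : w.length = Γ.dist x y) :
    IsGeodesicOn Γ (fun i => w.getVert i.toNat) (Set.Icc 0 w.length) := by
  have hdist : ∀ i j : ℕ, i ≤ j → j ≤ w.length → Γ.dist (w.getVert i) (w.getVert j) = j - i := by
    intro i j hij hj
    have hsub : ((w.drop i).take (j - i)).IsSubwalk w :=
      (SimpleGraph.Walk.isSubwalk_take _ _).trans (SimpleGraph.Walk.isSubwalk_drop _ _)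
    have hlen := SimpleGraph.length_eq_dist_of_subwalk hw hsub
    rw [SimpleGraph.Walk.take_length, SimpleGraph.Walk.drop_length,
      SimpleGraph.Walk.drop_getVert, Nat.add_sub_cancel' hij] at hlen
    omega
  rintro i ⟨hi₀, hi⟩ j ⟨hj₀, hj⟩
  rcases le_total i j with hij | hij
  · rw [hdist _ _ (by omega) (by omega)]
    omega
  · rw [Γ.dist_comm, hdist _ _ (by omega) (by omega)]
    omega

theorem IsBetween.exists_isGeodesicOn (hΓ : Γ.Connected) {x v y : V} (hv : IsBetween Γ x v y) :
    ∃ p : ℤ → V, IsGeodesicOn Γ p (Set.Icc 0 (Γ.dist x y)) ∧ p 0 = x ∧ p (Γ.dist x v) = v ∧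
      p (Γ.dist x y) = y := by
  obtain ⟨w₁, hw₁⟩ := hΓ.exists_walk_length_eq_dist x v
  obtain ⟨w₂, hw₂⟩ := hΓ.exists_walk_length_eq_dist v y
  have hw : (w₁.append w₂).length = Γ.dist x y := by
    rw [SimpleGraph.Walk.length_append, hw₁, hw₂, hv]
  refine ⟨fun i => (w₁.append w₂).getVert i.toNat, hw ▸ isGeodesicOn_getVert hw, ?_, ?_, ?_⟩
  · simp
  · simp [SimpleGraph.Walk.getVert_append, ← hw₁]
  · simp only [← hw, Int.toNat_natCast, SimpleGraph.Walk.getVert_length]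

theorem exists_isGeodesicOn (hΓ : Γ.Connected) (x y : V) :
    ∃ p : ℤ → V, IsGeodesicOn Γ p (Set.Icc 0 (Γ.dist x y)) ∧ p 0 = x ∧ p (Γ.dist x y) = y := by
  have hx : IsBetween Γ x x y := by simp [IsBetween]
  obtain ⟨p, hp, hp₀, -, hp₁⟩ := hx.exists_isGeodesicOn hΓ
  exact ⟨p, hp, hp₀, hp₁⟩

theorem abs_dist_sub_dist_le_one (hΓ : Γ.Connected) (a : V) {u v : V} (huv : Γ.Adj u v) :
    |(Γ.dist a u : ℝ) - Γ.dist a v| ≤ 1 := by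
  have h₁ : Γ.dist a u ≤ Γ.dist a v + Γ.dist v u := hΓ.dist_triangle
  have h₂ : Γ.dist a v ≤ Γ.dist a u + Γ.dist u v := hΓ.dist_triangle
  rw [SimpleGraph.dist_eq_one_iff_adj.2 huv.symm] at h₁
  rw [SimpleGraph.dist_eq_one_iff_adj.2 huv] at h₂
  rw [abs_le]
  constructor <;> linarith [(mod_cast h₁ : (Γ.dist a u : ℝ) ≤ Γ.dist a v + 1),
    (mod_cast h₂ : (Γ.dist a v : ℝ) ≤ Γ.dist a u + 1)]

end Graph

/-! ### Paths in the realization -/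

theorem IsGeodesicSegment.symm {X : Type*} [MetricSpace X] {x y : X} {σ : Set X}
    (hσ : IsGeodesicSegment x y σ) : IsGeodesicSegment y x σ := by
  obtain ⟨c, rfl, hy, hc, rfl⟩ := hσ
  have hmem : ∀ {t}, t ∈ Set.Icc 0 (dist (c 0) y) →
      dist (c 0) y - t ∈ Set.Icc 0 (dist (c 0) y) :=
    fun ht => ⟨by linarith [ht.2], by linarith [ht.1]⟩
  simp only [IsGeodesicSegment, dist_comm y]
  refine ⟨fun t => c (dist (c 0) y - t), by simpa, by simp, fun s hs t ht => ?_, ?_⟩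
  · rw [hc _ (hmem hs) _ (hmem ht), sub_sub_sub_cancel_left, abs_sub_comm]
  · ext p
    constructor <;> rintro ⟨t, ht, rfl⟩ <;> exact ⟨_, hmem ht, by simp⟩

namespace Realization

variable {V : Type*} {Γ : SimpleGraph V} {hΓ : Γ.Connected}

/-- The affine extension to the realization of a function on the vertices. -/
def interp (f : V → ℝ) (x : Realization Γ hΓ) : ℝ := ∑ᶠ w, x.coord w * f w

theorem interp_of_coord (f : V → ℝ) {x : Realization Γ hΓ} {u v : V} {s : ℝ}
    (hx : x.coord = edgeCoord u v s) : interp f x = (1 - s) * f u + s * f v := by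
  classical
  have hsummand : ∀ w, x.coord w * f w =
      (if w = u then (1 - s) * f u else 0) + if w = v then s * f v else 0 := by
    intro w
    simp only [hx, edgeCoord]
    split_ifs <;> subst_vars <;> ring
  have hfinite : ∀ (a : V) (r : ℝ), (Function.support fun w => if w = a then r else 0).Finite :=
    fun a r => (Set.finite_singleton a).subset fun w hw => by_contra fun h => hw (if_neg h)
  rw [interp, finsum_congr hsummand, finsum_add_distrib (hfinite _ _) (hfinite _ _),
    finsum_eq_single _ u fun w hw => if_neg hw, finsum_eq_single _ v fun w hw => if_neg hw,
    if_pos rfl, if_pos rfl]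

theorem interp_vertex (f : V → ℝ) (u : V) : interp f (vertex u : Realization Γ hΓ) = f u := by
  rw [interp_of_coord f (u := u) (v := u) (s := 0) rfl]
  ring

theorem abs_interp_sub_le {f : V → ℝ} (hf : ∀ u v, Γ.Adj u v → |f u - f v| ≤ 1)
    (x y : Realization Γ hΓ) : |interp f x - interp f y| ≤ dist x y := by
  refine le_csInf (exists_chain x y) fun a hxy => ?_
  induction hxy with
  | nil => simp
  | cons u v huv s t _ _ x y z hx hy ℓ _ ih =>
    refine (abs_sub_le _ (interp f y) _).trans (add_le_add ?_ ih)
    rw [interp_of_coord f hx, interp_of_coord f hy]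
    have hsub : (1 - s) * f u + s * f v - ((1 - t) * f u + t * f v) =
        -((s - t) * (f u - f v)) := by ring
    rw [hsub, abs_neg, abs_mul]
    exact mul_le_of_le_one_right (abs_nonneg _) (hf u v huv)

theorem abs_interp_dist_sub_le (a : V) (x y : Realization Γ hΓ) :
    |interp (fun v => (Γ.dist a v : ℝ)) x - interp (fun v => (Γ.dist a v : ℝ)) y| ≤ dist x y :=
  abs_interp_sub_le (fun _ _ => abs_dist_sub_dist_le_one hΓ a) x y

theorem edgeCoord_zero (u v : V) : edgeCoord u v 0 = edgeCoord u u 0 := by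
  funext w
  simp [edgeCoord]

theorem edgeCoord_one (u v : V) : edgeCoord u v 1 = edgeCoord v v 0 := by
  funext w
  simp [edgeCoord]

theorem dist_le_of_coord {x y : Realization Γ hΓ} {u v : V} (huv : Γ.Adj u v) {s t : ℝ}
    (hs : s ∈ Set.Icc (0 : ℝ) 1) (ht : t ∈ Set.Icc (0 : ℝ) 1) (hx : x.coord = edgeCoord u v s)
    (hy : y.coord = edgeCoord u v t) : dist x y ≤ |s - t| :=
  csInf_le (bddBelow_chain x y)
    (by simpa using IsChain.cons u v huv s t hs ht x y y hx hy 0 (.nil y))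

theorem dist_vertex (u v : V) :
    dist (vertex u : Realization Γ hΓ) (vertex v) = Γ.dist u v := by
  apply le_antisymm
  · obtain ⟨p, hp⟩ := hΓ.exists_walk_length_eq_dist u v
    rw [← hp]
    clear hp
    induction p with
    | nil => simp
    | @cons u v w huv p ih =>
      have hedge : dist (vertex u : Realization Γ hΓ) (vertex v) ≤ 1 := by
        simpa using dist_le_of_coord (x := vertex u) (y := vertex v) (hΓ := hΓ) huv (s := 0)
          (t := 1) (by simp) (by simp) (edgeCoord_zero u v).symm (edgeCoord_one u v).symm
      rw [SimpleGraph.Walk.length_cons, Nat.cast_add_one]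
      linarith [dist_triangle (vertex u : Realization Γ hΓ) (vertex v) (vertex w)]
  · simpa [interp_vertex] using
      abs_interp_dist_sub_le u (vertex u : Realization Γ hΓ) (vertex v)

open Classical in
/-- The path in the realization that is at the vertex `p i` at the integer time `i` and that moves
with unit speed along the edge from `p i` to `p (i + 1)`. Where there is no such edge, it waits at
`p i` and then jumps. -/
def path (p : ℤ → V) (t : ℝ) : Realization Γ hΓ :=
  if h : Γ.Adj (p ⌊t⌋) (p (⌊t⌋ + 1)) then
    ⟨edgeCoord (p ⌊t⌋) (p (⌊t⌋ + 1)) (Int.fract t), _, _, .inr h, _,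
      ⟨Int.fract_nonneg t, (Int.fract_lt_one t).le⟩, rfl⟩
  else vertex (p ⌊t⌋)

variable {p : ℤ → V}

theorem path_intCast (i : ℤ) : (path p i : Realization Γ hΓ) = vertex (p i) := by
  simp only [path, Int.floor_intCast, Int.fract_intCast, edgeCoord_zero]
  split_ifs <;> rfl

theorem vertex_mem_path_image {a b i : ℤ} (hi : i ∈ Set.uIcc a b) :
    (vertex (p i) : Realization Γ hΓ) ∈ path p '' Set.uIcc (a : ℝ) b := by
  refine ⟨i, ?_, path_intCast i⟩
  rw [Set.mem_uIcc] at hi ⊢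
  exact_mod_cast hi

theorem coord_path {i : ℤ} (h : Γ.Adj (p i) (p (i + 1))) {t : ℝ}
    (ht : t ∈ Set.Icc (i : ℝ) (i + 1)) :
    (path p t : Realization Γ hΓ).coord = edgeCoord (p i) (p (i + 1)) (t - i) := by
  rcases ht.2.lt_or_eq with hlt | rfl
  · obtain rfl : ⌊t⌋ = i := Int.floor_eq_iff.2 ⟨ht.1, hlt⟩
    simp only [path, dif_pos h, Int.self_sub_floor]
  · have hvertex : (path p (i + 1 : ℝ) : Realization Γ hΓ) = vertex (p (i + 1)) := by
      exact_mod_cast path_intCast (hΓ := hΓ) (p := p) (i + 1)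
    rw [hvertex, add_sub_cancel_left, edgeCoord_one, vertex]

theorem dist_path_le {i : ℤ} (h : Γ.Adj (p i) (p (i + 1))) {s t : ℝ}
    (hs : s ∈ Set.Icc (i : ℝ) (i + 1)) (ht : t ∈ Set.Icc (i : ℝ) (i + 1)) :
    dist (path p s : Realization Γ hΓ) (path p t) ≤ |s - t| := by
  have hsub : ∀ {r : ℝ}, r ∈ Set.Icc (i : ℝ) (i + 1) → r - i ∈ Set.Icc (0 : ℝ) 1 :=
    fun hr => ⟨by linarith [hr.1], by linarith [hr.2]⟩
  simpa using dist_le_of_coord h (hsub hs) (hsub ht) (coord_path (hΓ := hΓ) h hs) (coord_path h ht)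

theorem interp_dist_path {a b : ℤ} (hp : IsGeodesicOn Γ p (Set.Icc a b)) {t : ℝ}
    (ht : t ∈ Set.Icc (a : ℝ) b) :
    interp (fun v => (Γ.dist (p a) v : ℝ)) (path p t : Realization Γ hΓ) = t - a := by
  have hvertex : ∀ i ∈ Set.Icc a b, (Γ.dist (p a) (p i) : ℝ) = i - a := by
    intro i hi
    have hdist : (Γ.dist (p a) (p i) : ℤ) = i - a := by
      rw [hp a ⟨le_rfl, hi.1.trans hi.2⟩ i hi]
      exact Int.natAbs_of_nonneg (sub_nonneg.2 hi.1)
    exact_mod_cast hdist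
  have hfloor : ⌊t⌋ ∈ Set.Icc a b :=
    ⟨Int.le_floor.2 ht.1, Int.cast_le.1 ((Int.floor_le t).trans ht.2)⟩
  rcases hfloor.2.lt_or_eq with hlt | rfl
  · have hsucc : ⌊t⌋ + 1 ∈ Set.Icc a b := ⟨Int.le_add_one hfloor.1, hlt⟩
    rw [interp_of_coord _ (coord_path (hp.adj hfloor hsucc)
      ⟨Int.floor_le t, (Int.lt_floor_add_one t).le⟩), hvertex _ hfloor, hvertex _ hsucc]
    push_cast
    ring
  · have hint : t = ⌊t⌋ := le_antisymm ht.2 (Int.floor_le t)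
    rw [hint, path_intCast, interp_vertex, hvertex _ hfloor]

theorem dist_path_le_of_floor_eq (p : ℤ → V) {s t : ℝ} (h : ⌊s⌋ = ⌊t⌋) :
    dist (path p s : Realization Γ hΓ) (path p t) ≤ |s - t| := by
  by_cases hadj : Γ.Adj (p ⌊t⌋) (p (⌊t⌋ + 1))
  · exact dist_path_le hadj (h ▸ ⟨Int.floor_le s, (Int.lt_floor_add_one s).le⟩)
      ⟨Int.floor_le t, (Int.lt_floor_add_one t).le⟩
  · have heq : (path p s : Realization Γ hΓ) = path p t := by
      rw [path, path, dif_neg hadj, dif_neg (h ▸ hadj), h]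
    rw [heq, dist_self]
    exact abs_nonneg _

theorem dist_path_le_of_le {a b : ℤ} (hp : IsGeodesicOn Γ p (Set.Icc a b)) {s t : ℝ}
    (hs : a ≤ s) (hst : s ≤ t) (ht : t ≤ b) :
    dist (path p s : Realization Γ hΓ) (path p t) ≤ t - s := by
  have has : a ≤ ⌊s⌋ := Int.le_floor.2 hs
  have htb : ⌊t⌋ ≤ b := Int.cast_le.1 ((Int.floor_le t).trans ht)
  rcases (Int.floor_le_floor hst).eq_or_lt with hfloor | hfloor
  · rw [← abs_of_nonneg (sub_nonneg.2 hst), abs_sub_comm]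
    exact dist_path_le_of_floor_eq p hfloor
  have hstart : dist (path p s : Realization Γ hΓ) (path p (⌊s⌋ + 1 : ℤ)) ≤ ⌊s⌋ + 1 - s := by
    rw [← abs_of_pos (sub_pos.2 (Int.lt_floor_add_one s)), abs_sub_comm]
    exact_mod_cast dist_path_le (hp.adj (i := ⌊s⌋) ⟨has, by omega⟩ ⟨by omega, by omega⟩)
      ⟨Int.floor_le s, (Int.lt_floor_add_one s).le⟩ (t := (⌊s⌋ + 1 : ℝ)) ⟨by linarith, le_rfl⟩
  have hmiddle : dist (path p (⌊s⌋ + 1 : ℤ) : Realization Γ hΓ) (path p ⌊t⌋) =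
      ⌊t⌋ - (⌊s⌋ + 1) := by
    rw [path_intCast, path_intCast, dist_vertex,
      hp _ ⟨by omega, by omega⟩ _ ⟨by omega, htb⟩, Nat.cast_natAbs, abs_of_nonneg (by omega)]
    push_cast
    ring
  have hend : dist (path p ⌊t⌋ : Realization Γ hΓ) (path p t) ≤ t - ⌊t⌋ := by
    rw [← abs_of_nonneg (sub_nonneg.2 (Int.floor_le t)), abs_sub_comm]
    exact dist_path_le_of_floor_eq p (Int.floor_intCast _)
  linarith [dist_triangle4 (path p s : Realization Γ hΓ) (path p (⌊s⌋ + 1 : ℤ)) (path p ⌊t⌋)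
    (path p t)]

theorem dist_path {a b : ℤ} (hp : IsGeodesicOn Γ p (Set.Icc a b)) {s t : ℝ}
    (hs : s ∈ Set.Icc (a : ℝ) b) (ht : t ∈ Set.Icc (a : ℝ) b) :
    dist (path p s : Realization Γ hΓ) (path p t) = |s - t| := by
  wlog hst : s ≤ t generalizing s t
  · rw [dist_comm, this ht hs (le_of_not_ge hst), abs_sub_comm]
  apply le_antisymm
  · rw [abs_sub_comm, abs_of_nonneg (sub_nonneg.2 hst)]
    exact dist_path_le_of_le hp hs.1 hst ht.2
  · simpa [interp_dist_path hp hs, interp_dist_path hp ht] using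
      abs_interp_dist_sub_le (p a) (path p s : Realization Γ hΓ) (path p t)

theorem isometry_path (hp : IsGeodesicOn Γ p Set.univ) :
    Isometry (path p : ℝ → Realization Γ hΓ) := by
  refine Isometry.of_dist_eq fun s t => ?_
  have hs : s ∈ Set.Icc (⌊min s t⌋ : ℝ) ⌈max s t⌉ :=
    ⟨(Int.floor_le _).trans (min_le_left _ _), (le_max_left _ _).trans (Int.le_ceil _)⟩
  have ht : t ∈ Set.Icc (⌊min s t⌋ : ℝ) ⌈max s t⌉ :=
    ⟨(Int.floor_le _).trans (min_le_right _ _), (le_max_right _ _).trans (Int.le_ceil _)⟩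
  exact dist_path (hp.mono (Set.subset_univ _)) hs ht

theorem isGeodesicSegment_path {a b : ℤ} (hp : IsGeodesicOn Γ p (Set.uIcc a b)) :
    IsGeodesicSegment (vertex (p a) : Realization Γ hΓ) (vertex (p b))
      (path p '' Set.uIcc (a : ℝ) b) := by
  wlog hab : a ≤ b generalizing a b
  · rw [Set.uIcc_comm] at hp ⊢
    exact (this hp (le_of_not_ge hab)).symm
  have hab' : (a : ℝ) ≤ b := Int.cast_le.2 hab
  rw [Set.uIcc_of_le hab] at hp
  have hlength : dist (vertex (p a) : Realization Γ hΓ) (vertex (p b)) = b - a := by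
    rw [← path_intCast, ← path_intCast, dist_path hp ⟨le_rfl, hab'⟩ ⟨hab', le_rfl⟩, abs_sub_comm,
      abs_of_nonneg (sub_nonneg.2 hab')]
  have himage : Set.Icc (a : ℝ) b = (· + (a : ℝ)) '' Set.Icc (0 : ℝ) (b - a) := by simp
  rw [IsGeodesicSegment, hlength, Set.uIcc_of_le hab', himage, Set.image_image]
  refine ⟨fun t => path p (t + a), by simp [path_intCast], by simp [path_intCast], ?_, rfl⟩
  intro s hs t ht
  rw [dist_path hp ⟨by linarith [hs.1], by linarith [hs.2]⟩
    ⟨by linarith [ht.1], by linarith [ht.2]⟩, add_sub_add_right_eq_sub]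

theorem dist_floor_le_or_dist_ceil_le (v : V) (p : ℤ → V) (t : ℝ) :
    (Γ.dist v (p ⌊t⌋) : ℝ) ≤ dist (vertex v : Realization Γ hΓ) (path p t) ∨
      (Γ.dist v (p ⌈t⌉) : ℝ) ≤ dist (vertex v : Realization Γ hΓ) (path p t) := by
  by_cases hfract : Int.fract t = 0
  · obtain ⟨i, rfl⟩ : t ∈ Set.range ((↑) : ℤ → ℝ) := Int.fract_eq_zero_iff.1 hfract
    rw [path_intCast, dist_vertex, Int.floor_intCast]
    exact .inl le_rfl
  by_cases hadj : Γ.Adj (p ⌊t⌋) (p (⌊t⌋ + 1))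
  · have hinterp := abs_interp_dist_sub_le v (path p t : Realization Γ hΓ) (vertex v)
    rw [interp_vertex, SimpleGraph.dist_self, Nat.cast_zero, sub_zero, dist_comm,
      interp_of_coord _ (coord_path hadj ⟨Int.floor_le t, (Int.lt_floor_add_one t).le⟩)] at hinterp
    have hle := (le_abs_self _).trans hinterp
    have hfloor := Int.floor_le t
    have hceil := Int.lt_floor_add_one t
    have hsucc : ⌈t⌉ = ⌊t⌋ + 1 :=
      (Int.ceil_eq_floor_add_one_iff_notMem t).2 fun h => hfract (Int.fract_eq_zero_iff.2 h)
    rw [hsucc]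
    rcases le_total (Γ.dist v (p ⌊t⌋) : ℝ) (Γ.dist v (p (⌊t⌋ + 1))) with h | h
    · left; nlinarith
    · right; nlinarith
  · rw [path, dif_neg hadj, dist_vertex]
    exact .inl le_rfl

theorem exists_dist_le_of_mem_path {a b : ℤ} {q : Realization Γ hΓ}
    (hq : q ∈ path p '' Set.uIcc (a : ℝ) b) (v : V) :
    ∃ i ∈ Set.uIcc a b, (Γ.dist v (p i) : ℝ) ≤ dist (vertex v) q := by
  obtain ⟨t, ht, rfl⟩ := hq
  simp only [Set.uIcc, Set.mem_Icc, ← Int.cast_min, ← Int.cast_max] at ht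
  rcases dist_floor_le_or_dist_ceil_le v p t with h | h
  · exact ⟨⌊t⌋, ⟨Int.le_floor.2 ht.1, Int.cast_le.1 ((Int.floor_le t).trans ht.2)⟩, h⟩
  · exact ⟨⌈t⌉, ⟨Int.cast_le.1 (ht.1.trans (Int.le_ceil t)), Int.ceil_le.2 ht.2⟩, h⟩

end Realization

/-- Hyperbolicity in terms of vertices: in a triangle of which one side is the geodesic `p` from
`p a` to `p b`, a vertex `v` of the side from `x` to `p a` is at distance at most `n` from a vertex
of one of the other two sides. -/
def VertexHyperbolic {V : Type*} (Γ : SimpleGraph V) (n : ℕ) : Prop :=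
  ∀ ⦃p : ℤ → V⦄ ⦃a b : ℤ⦄, IsGeodesicOn Γ p (Set.uIcc a b) →
    ∀ ⦃x v : V⦄, IsBetween Γ x v (p a) →
      (∃ i ∈ Set.uIcc a b, Γ.dist v (p i) ≤ n) ∨ ∃ w, IsBetween Γ x w (p b) ∧ Γ.dist v w ≤ n

theorem IsHyperbolic.vertexHyperbolic {V : Type*} {Γ : SimpleGraph V} {hΓ : Γ.Connected} {δ : ℝ}
    (hδ : IsHyperbolic (Realization Γ hΓ) δ) : VertexHyperbolic Γ ⌊δ⌋₊ := by
  intro p a b hp x v hv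
  obtain ⟨c, hc, hcx, hcv, hca⟩ := hv.exists_isGeodesicOn hΓ
  obtain ⟨e, he, heb, hex⟩ := exists_isGeodesicOn hΓ (p b) x
  rw [← Set.uIcc_of_le (by omega)] at hc he
  have hxa := Realization.isGeodesicSegment_path (hΓ := hΓ) hc
  have hbx := Realization.isGeodesicSegment_path (hΓ := hΓ) he
  rw [hcx, hca] at hxa
  rw [heb, hex] at hbx
  have hvxa : (Realization.vertex v : Realization Γ hΓ) ∈
      Realization.path c '' Set.uIcc ((0 : ℤ) : ℝ) (Γ.dist x (p a) : ℤ) := by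
    rw [← hcv]
    refine Realization.vertex_mem_path_image (Set.mem_uIcc.2 (.inl ⟨by omega, ?_⟩))
    exact_mod_cast hv ▸ Nat.le_add_right _ _
  obtain ⟨q, hq | hq, hvq⟩ :=
    hδ.2 _ _ _ _ _ _ hxa (Realization.isGeodesicSegment_path hp) hbx _ hvxa
  · obtain ⟨i, hi, hvi⟩ := Realization.exists_dist_le_of_mem_path hq v
    exact .inl ⟨i, hi, Nat.le_floor (hvi.trans hvq)⟩
  · obtain ⟨i, hi, hvi⟩ := Realization.exists_dist_le_of_mem_path hq v
    have hmem := he.isBetween Set.left_mem_uIcc hi Set.right_mem_uIcc hi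
    rw [heb, hex, isBetween_comm] at hmem
    exact .inr ⟨e i, hmem, Nat.le_floor (hvi.trans hvq)⟩

/-! ### Stability of local geodesics -/

section LocalGeodesic

variable {V : Type*} {Γ : SimpleGraph V} {n : ℕ}

/-- The sequence of vertices `c` is an `N`-local geodesic: its pieces of length at most `N` are
geodesic. -/
def IsLocalGeodesic (Γ : SimpleGraph V) (c : ℤ → V) (N : ℕ) : Prop :=
  ∀ ⦃i j : ℤ⦄, (j - i).natAbs ≤ N → Γ.dist (c i) (c j) = (j - i).natAbs

theorem isLocalGeodesic_of_dist_add {c : ℤ → V} {N : ℕ}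
    (h : ∀ i (m : ℕ), m ≤ N → Γ.dist (c i) (c (i + m)) = m) : IsLocalGeodesic Γ c N := by
  intro i j hij
  rcases le_total i j with hle | hle <;> obtain ⟨m, rfl⟩ := Int.le.dest hle
  · rw [h i m (by omega)]
    omega
  · rw [SimpleGraph.dist_comm, h j m (by omega)]
    omega

theorem IsLocalGeodesic.mono {c : ℤ → V} {M N : ℕ} (hc : IsLocalGeodesic Γ c N) (h : M ≤ N) :
    IsLocalGeodesic Γ c M :=
  fun _ _ hij => hc (hij.trans h)

/-- The balls of each radius have uniformly bounded cardinality. -/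
def BoundedGeometry (Γ : SimpleGraph V) : Prop :=
  ∀ r : ℕ, ∃ B : ℕ, ∀ v, {w | Γ.dist v w ≤ r}.encard ≤ B

theorem BoundedGeometry.finite_ball (hB : BoundedGeometry Γ) (v : V) (r : ℕ) :
    {w | Γ.dist v w ≤ r}.Finite := by
  obtain ⟨B, hB⟩ := hB r
  exact Set.finite_of_encard_le_coe (hB v)

theorem VertexHyperbolic.quadrilateral (hn : VertexHyperbolic Γ n) (hΓ : Γ.Connected) {p : ℤ → V}
    {a b : ℤ} (hp : IsGeodesicOn Γ p (Set.uIcc a b)) {x y z : V} (hx : IsBetween Γ y x z) :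
    (∃ i ∈ Set.uIcc a b, Γ.dist x (p i) ≤ 2 * n) ∨
      (∃ w, IsBetween Γ y w (p a) ∧ Γ.dist x w ≤ 2 * n) ∨
      ∃ w, IsBetween Γ z w (p b) ∧ Γ.dist x w ≤ 2 * n := by
  obtain ⟨e, he, rfl, heb⟩ := exists_isGeodesicOn hΓ z (p b)
  rw [← Set.uIcc_of_le (by omega)] at he
  rcases hn he hx with ⟨i, hi, hxi⟩ | ⟨v, hv, hxv⟩
  · exact .inr (.inr ⟨e i, heb ▸ he.isBetween Set.left_mem_uIcc hi Set.right_mem_uIcc hi, by omega⟩)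
  rw [heb] at hv
  rw [Set.uIcc_comm] at hp ⊢
  rcases hn hp hv with ⟨i, hi, hvi⟩ | ⟨w, hw, hvw⟩
  · have hxi : Γ.dist x (p i) ≤ Γ.dist x v + Γ.dist v (p i) := hΓ.dist_triangle
    exact .inl ⟨i, hi, by omega⟩
  · have hxw : Γ.dist x w ≤ Γ.dist x v + Γ.dist v w := hΓ.dist_triangle
    exact .inr (.inl ⟨w, hw, by omega⟩)

theorem IsBetween.lt_dist (hΓ : Γ.Connected) {x y z w : V} {k : ℕ} (hw : IsBetween Γ y w z)
    (hxz : k < Γ.dist x z) (hyz : Γ.dist y z ≤ Γ.dist x z)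
    (hxy : Γ.dist y z = 0 ∨ 2 * k < Γ.dist x y) : k < Γ.dist x w := by
  have hz : Γ.dist x z ≤ Γ.dist x w + Γ.dist w z := hΓ.dist_triangle
  have hy : Γ.dist x y ≤ Γ.dist x w + Γ.dist w y := hΓ.dist_triangle
  rw [Γ.dist_comm (u := w)] at hy
  unfold IsBetween at hw
  omega

theorem VertexHyperbolic.exists_dist_le (hn : VertexHyperbolic Γ n) (hΓ : Γ.Connected) {p : ℤ → V}
    {a b : ℤ} (hp : IsGeodesicOn Γ p (Set.uIcc a b)) {x y z : V} (hx : IsBetween Γ y x z)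
    (hya : Γ.dist y (p a) ≤ Γ.dist x (p a)) (hy : Γ.dist y (p a) = 0 ∨ 4 * n < Γ.dist x y)
    (hzb : Γ.dist z (p b) ≤ Γ.dist x (p b)) (hz : Γ.dist z (p b) = 0 ∨ 4 * n < Γ.dist x z) :
    ∃ i ∈ Set.uIcc a b, Γ.dist x (p i) ≤ 2 * n := by
  rcases hn.quadrilateral hΓ hp hx with hi | ⟨w, hw, hxw⟩ | ⟨w, hw, hxw⟩
  · exact hi
  · refine ⟨a, Set.left_mem_uIcc, ?_⟩
    by_contra! hfar
    exact hxw.not_gt (hw.lt_dist hΓ hfar hya (by omega))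
  · refine ⟨b, Set.right_mem_uIcc, ?_⟩
    by_contra! hfar
    exact hxw.not_gt (hw.lt_dist hΓ hfar hzb (by omega))

namespace IsLocalGeodesic

variable {c : ℤ → V}

theorem exists_dist_le (hn : VertexHyperbolic Γ n) (hΓ : Γ.Connected)
    (hc : IsLocalGeodesic Γ c (8 * n + 2)) {p : ℤ → V} {a' b' a b : ℤ}
    (hp : IsGeodesicOn Γ p (Set.uIcc a' b')) (ha : p a' = c a) (hb : p b' = c b) {i : ℤ}
    (hi : i ∈ Set.Icc a b) : ∃ k ∈ Set.uIcc a' b', Γ.dist (c i) (p k) ≤ 2 * n := by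
  have hclosest : ∀ i, ∃ k ∈ Set.uIcc a' b', ∀ l ∈ Set.uIcc a' b',
      Γ.dist (c i) (p k) ≤ Γ.dist (c i) (p l) := fun i =>
    Set.exists_min_image _ _ (Set.finite_Icc _ _) Set.nonempty_uIcc
  choose π hπ hπmin using hclosest
  -- It suffices to bound the distance at the point of `c` that is farthest from `p`.
  obtain ⟨m, hm, hmax⟩ := Set.exists_max_image (Set.Icc a b) (fun i => Γ.dist (c i) (p (π i)))
    (Set.finite_Icc _ _) ⟨i, hi⟩
  refine ⟨π i, hπ i, (hmax i hi).trans ?_⟩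
  have ha₀ : Γ.dist (c a) (p (π a)) = 0 := by
    simpa [ha] using hπmin a a' Set.left_mem_uIcc
  have hb₀ : Γ.dist (c b) (p (π b)) = 0 := by
    simpa [hb] using hπmin b b' Set.right_mem_uIcc
  obtain ⟨y, hay, hym, hmy, hy⟩ : ∃ y, a ≤ y ∧ y ≤ m ∧ m ≤ y + (4 * n + 1) ∧
      (y = a ∨ m = y + (4 * n + 1)) := ⟨max a (m - (4 * n + 1)), by have := hm.1; omega⟩
  obtain ⟨z, hzb, hmz, hzm, hz⟩ : ∃ z, z ≤ b ∧ m ≤ z ∧ z ≤ m + (4 * n + 1) ∧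
      (z = b ∨ z = m + (4 * n + 1)) := ⟨min b (m + (4 * n + 1)), by have := hm.2; omega⟩
  have hbetween : IsBetween Γ (c y) (c m) (c z) := by
    rw [IsBetween, hc (by omega), hc (by omega), hc (by omega)]
    omega
  have hsub := Set.uIcc_subset_uIcc (hπ y) (hπ z)
  obtain ⟨k, hk, hmk⟩ := hn.exists_dist_le hΓ (hp.mono hsub) hbetween
    ((hmax y ⟨hay, hym.trans hm.2⟩).trans (hπmin m _ (hπ y)))
    (hy.imp (by rintro rfl; exact ha₀) fun h => by rw [hc (by omega)]; omega)
    ((hmax z ⟨hm.1.trans hmz, hzb⟩).trans (hπmin m _ (hπ z)))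
    (hz.imp (by rintro rfl; exact hb₀) fun h => by rw [hc (by omega)]; omega)
  exact (hπmin m k (hsub hk)).trans hmk

theorem injective (hn : VertexHyperbolic Γ n) (hΓ : Γ.Connected)
    (hc : IsLocalGeodesic Γ c (8 * n + 2)) : Function.Injective c := by
  intro i j hij
  wlog hlt : i < j generalizing i j
  · by_contra hne
    exact hne (this hij.symm (by omega)).symm
  rcases le_total j (i + (8 * n + 2)) with hle | hle
  · have hdist := hc (i := i) (j := j) (by omega)
    rw [hij, Γ.dist_self] at hdist
    omega
  · have hconst : IsGeodesicOn Γ (fun _ => c i) (Set.uIcc 0 0) := by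
      simp [IsGeodesicOn]
    obtain ⟨k, -, hk⟩ := hc.exists_dist_le hn hΓ hconst rfl hij (i := i + (4 * n + 1))
      ⟨by omega, by omega⟩
    rw [hc (by omega)] at hk
    omega

theorem natAbs_sub_lt (hn : VertexHyperbolic Γ n) (hΓ : Γ.Connected)
    (hc : IsLocalGeodesic Γ c (8 * n + 2)) {B : ℕ} (hB : ∀ v, {w | Γ.dist v w ≤ 2 * n}.encard ≤ B)
    (i j : ℤ) : (j - i).natAbs < B * (Γ.dist (c i) (c j) + 1) := by
  wlog hij : i ≤ j generalizing i j
  · rw [← Int.natAbs_neg, neg_sub, Γ.dist_comm]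
    exact this j i (le_of_not_ge hij)
  obtain ⟨p, hp, hpi, hpj⟩ := exists_isGeodesicOn hΓ (c i) (c j)
  rw [← Set.uIcc_of_le (by omega)] at hp
  choose! f hf hcf using fun m (hm : m ∈ Set.Icc i j) => hc.exists_dist_le hn hΓ hp hpi hpj hm
  have hfiber : ∀ k ∈ Finset.Icc (0 : ℤ) (Γ.dist (c i) (c j)),
      ((Finset.Icc i j).filter (f · = k)).card ≤ B := by
    intro k _
    rw [← Nat.cast_le (α := ℕ∞), ← Set.encard_coe_eq_coe_finsetCard,
      ← (hc.injective hn hΓ).injOn.encard_image]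
    refine (Set.encard_le_encard ?_).trans (hB (p k))
    rintro _ ⟨m, hm, rfl⟩
    obtain ⟨hmem, rfl⟩ := Finset.mem_filter.1 (Finset.mem_coe.1 hm)
    exact Γ.dist_comm.trans_le (hcf m (Finset.mem_Icc.1 hmem))
  have hmaps : ∀ m ∈ Finset.Icc i j, f m ∈ Finset.Icc (0 : ℤ) (Γ.dist (c i) (c j)) := by
    intro m hm
    have hfm := hf m (Finset.mem_Icc.1 hm)
    rwa [Set.uIcc_of_le (by omega), ← Finset.coe_Icc, Finset.mem_coe] at hfm
  have hcard := Finset.card_le_mul_card_image_of_maps_to hmaps B hfiber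
  have htoNat : ((Γ.dist (c i) (c j) : ℤ) + 1).toNat = Γ.dist (c i) (c j) + 1 := by omega
  rw [Int.card_Icc, Int.card_Icc, sub_zero, htoNat] at hcard
  omega

end IsLocalGeodesic

end LocalGeodesic

/-! ### From local geodesics to geodesic lines -/

section CoarseMonotone

variable {t : ℤ → ℤ} {L M : ℤ}

theorem lt_iff_lt_of_abs_sub_le (hL : ∀ i, |t (i + 1) - t i| ≤ L)
    (hM : ∀ i j, M ≤ j - i → L < |t j - t i|) {i j : ℤ} (hij : M ≤ j - i) :
    t i < t j ↔ t 0 < t M := by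
  have hright : ∀ i j, M ≤ j - i → (t i < t (j + 1) ↔ t i < t j) := by
    intro i j hij
    have := hL j
    have := hM i j hij
    have := hM i (j + 1) (by omega)
    grind
  have hleft : ∀ i j, M ≤ j - (i + 1) → (t (i + 1) < t j ↔ t i < t j) := by
    intro i j hij
    have := hL i
    have := hM (i + 1) j hij
    have := hM i j (by omega)
    grind
  have hshift : ∀ i, t (i + 1) < t (i + 1 + M) ↔ t i < t (i + M) := by
    intro i
    rw [hleft i _ (by omega), add_right_comm, hright i _ (by omega)]
  have hdiag : ∀ i, t i < t (i + M) ↔ t 0 < t M := by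
    intro i
    induction i with
    | zero => rw [zero_add]
    | succ i ih => rw [hshift, ih]
    | pred i ih => rw [← hshift, sub_add_cancel, ih]
  rw [← hdiag i]
  obtain ⟨k, hk⟩ := Int.le.dest hij
  obtain rfl : j = i + M + k := by omega
  clear hij hk
  induction k with
  | zero => simp
  | succ k ih =>
    rw [Nat.cast_succ, ← add_assoc]
    exact (hright i _ (by omega)).trans ih

theorem tendsto_atTop_and_tendsto_atBot_of_lt (ht : ∀ i j, M ≤ j - i → t i < t j)
    (hproper : ∀ r, ∃ M, ∀ i j, M ≤ j - i → r < |t j - t i|) :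
    Tendsto t atTop atTop ∧ Tendsto t atBot atBot := by
  refine ⟨tendsto_atTop.2 fun r => ?_, tendsto_atBot.2 fun r => ?_⟩
  · obtain ⟨N, hN⟩ := hproper (r - t 0)
    filter_upwards [eventually_ge_atTop (max M N)] with i hi
    have := ht 0 i (by omega)
    have := hN 0 i (by omega)
    grind
  · obtain ⟨N, hN⟩ := hproper (t 0 - r)
    filter_upwards [eventually_le_atBot (-max M N)] with i hi
    have := ht i 0 (by omega)
    have := hN i 0 (by omega)
    grind

theorem tendsto_or_tendsto_neg (hL : ∀ i, |t (i + 1) - t i| ≤ L)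
    (hproper : ∀ r, ∃ M, ∀ i j, M ≤ j - i → r < |t j - t i|) :
    (Tendsto t atTop atTop ∧ Tendsto t atBot atBot) ∨
      (Tendsto (-t) atTop atTop ∧ Tendsto (-t) atBot atBot) := by
  obtain ⟨M, hM⟩ := hproper L
  by_cases hlt : t 0 < t M
  · exact .inl (tendsto_atTop_and_tendsto_atBot_of_lt
      (fun i j hij => (lt_iff_lt_of_abs_sub_le hL hM hij).2 hlt) hproper)
  · refine .inr (tendsto_atTop_and_tendsto_atBot_of_lt (M := M) (fun i j hij => ?_) ?_)
    · have := hL 0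
      have := hM i j hij
      have := (lt_iff_lt_of_abs_sub_le hL hM hij).not.2 hlt
      have := abs_nonneg (t (0 + 1) - t 0)
      simp only [Pi.neg_apply]
      grind
    · simpa only [Pi.neg_apply, ← neg_sub', abs_neg] using hproper

end CoarseMonotone

section LimitGeodesic

variable {V : Type*} {Γ : SimpleGraph V}

theorem exists_eventually_eq {ι α : Type*} (U : Ultrafilter ι) {s : Set α} (hs : s.Finite)
    {f : ι → α} (hf : ∀ᶠ m in U, f m ∈ s) : ∃ a, ∀ᶠ m in U, f m = a := by
  have hmem : ∀ᶠ m in U, ∃ a ∈ s, f m = a := hf.mono fun m hm => ⟨f m, hm, rfl⟩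
  obtain ⟨a, -, ha⟩ := (Ultrafilter.eventually_exists_mem_iff hs).1 hmem
  exact ⟨a, ha⟩

theorem exists_limit_geodesic {ι : Type*} (U : Ultrafilter ι)
    (hfin : ∀ v r, {w | Γ.dist v w ≤ r}.Finite) (hΓ : Γ.Connected) {p : ι → ℤ → V}
    (hp : ∀ i j, ∀ᶠ m in U, Γ.dist (p m i) (p m j) = (j - i).natAbs) {v : V} {r : ℕ}
    (hv : ∀ᶠ m in U, Γ.dist v (p m 0) ≤ r) :
    ∃ γ : ℤ → V, IsGeodesicOn Γ γ Set.univ ∧ ∀ i, ∀ᶠ m in U, p m i = γ i := by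
  have hball : ∀ i, ∀ᶠ m in U, p m i ∈ {w | Γ.dist v w ≤ r + i.natAbs} := by
    intro i
    filter_upwards [hp 0 i, hv] with m hi h₀
    have htri : Γ.dist v (p m i) ≤ Γ.dist v (p m 0) + Γ.dist (p m 0) (p m i) := hΓ.dist_triangle
    rw [sub_zero] at hi
    exact htri.trans (by omega)
  choose γ hγ using fun i => exists_eventually_eq U (hfin v _) (hball i)
  refine ⟨γ, fun i _ j _ => ?_, hγ⟩
  obtain ⟨m, hij, hi, hj⟩ := ((hp i j).and ((hγ i).and (hγ j))).exists
  rw [← hi, ← hj, hij]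

end LimitGeodesic

section Line

variable {V : Type*} {Γ : SimpleGraph V} {n : ℕ}

namespace IsLocalGeodesic

variable {c : ℤ → V}

theorem exists_lt_dist (hn : VertexHyperbolic Γ n) (hΓ : Γ.Connected)
    (hB : BoundedGeometry Γ) (hc : IsLocalGeodesic Γ c (8 * n + 2)) (r : ℕ) :
    ∃ M : ℕ, ∀ i j : ℤ, M ≤ (j - i).natAbs → r < Γ.dist (c i) (c j) := by
  obtain ⟨B, hB⟩ := hB (2 * n)
  refine ⟨B * (r + 1), fun i j hij => ?_⟩
  by_contra! hle
  exact (hij.trans_lt (hc.natAbs_sub_lt hn hΓ hB i j)).not_ge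
    (Nat.mul_le_mul_left B (Nat.succ_le_succ hle))

theorem exists_isGeodesicOn_dist_le (hn : VertexHyperbolic Γ n) (hΓ : Γ.Connected)
    (hc : IsLocalGeodesic Γ c (8 * n + 2)) (m : ℕ) :
    ∃ (p : ℤ → V) (a b : ℤ), IsGeodesicOn Γ p (Set.Icc a b) ∧ 0 ∈ Set.Icc a b ∧
      p a = c (-m) ∧ p b = c m ∧ Γ.dist (c 0) (p 0) ≤ 2 * n := by
  obtain ⟨q, hq, hqa, hqb⟩ := exists_isGeodesicOn hΓ (c (-m)) (c m)
  obtain ⟨k, hk, hck⟩ := hc.exists_dist_le hn hΓ (by rwa [Set.uIcc_of_le (by omega)]) hqa hqb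
    (i := 0) (by simp)
  rw [Set.uIcc_of_le (by omega)] at hk
  refine ⟨fun i => q (i + k), -k, Γ.dist (c (-m)) (c m) - k, ?_, ?_, by simpa, by simpa, by simpa⟩
  · convert hq.comp_add_const k using 1
    simp
  · simpa using hk

theorem exists_isGeodesicOn_near (hn : VertexHyperbolic Γ n) (hΓ : Γ.Connected)
    (hB : BoundedGeometry Γ) (hc : IsLocalGeodesic Γ c (8 * n + 2)) (r : ℕ) :
    ∃ p : ℤ → V, IsGeodesicOn Γ p (Set.Icc (-r) r) ∧ Γ.dist (c 0) (p 0) ≤ 2 * n ∧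
      ∀ i : ℤ, i.natAbs ≤ r →
        ∃ k : ℤ, k.natAbs ≤ 4 * n + Γ.dist (c 0) (c i) ∧ Γ.dist (c i) (p k) ≤ 2 * n := by
  obtain ⟨M, hM⟩ := hc.exists_lt_dist hn hΓ hB (2 * n + r)
  obtain ⟨p, a, b, hp, h₀, ha, hb, hdist⟩ := hc.exists_isGeodesicOn_dist_le hn hΓ (max M r)
  have hab := h₀.1.trans h₀.2
  have hcoord : ∀ k ∈ Set.Icc a b, Γ.dist (p 0) (p k) = k.natAbs := fun k hk => by
    rw [hp 0 h₀ k hk, sub_zero]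
  have hfar : ∀ i : ℤ, M ≤ i.natAbs → r < Γ.dist (p 0) (c i) := by
    intro i hi
    have htri : Γ.dist (c 0) (c i) ≤ Γ.dist (c 0) (p 0) + Γ.dist (p 0) (c i) := hΓ.dist_triangle
    have := hM 0 i (by simpa using hi)
    omega
  have hleft : a ≤ -r := by
    have h := hfar (-(max M r : ℕ)) (by omega)
    rw [← ha, hcoord a (Set.left_mem_Icc.2 hab)] at h
    have := h₀.1
    omega
  have hright : r ≤ b := by
    have h := hfar (max M r : ℕ) (by omega)
    rw [← hb, hcoord b (Set.right_mem_Icc.2 hab)] at h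
    have := h₀.2
    omega
  refine ⟨p, hp.mono (Set.Icc_subset_Icc hleft hright), hdist, fun i hi => ?_⟩
  obtain ⟨k, hk, hck⟩ := hc.exists_dist_le hn hΓ (by rwa [Set.uIcc_of_le hab]) ha hb (i := i)
    ⟨by omega, by omega⟩
  rw [Set.uIcc_of_le hab] at hk
  refine ⟨k, ?_, hck⟩
  have h₁ : Γ.dist (p 0) (p k) ≤ Γ.dist (p 0) (c i) + Γ.dist (c i) (p k) := hΓ.dist_triangle
  have h₂ : Γ.dist (p 0) (c i) ≤ Γ.dist (p 0) (c 0) + Γ.dist (c 0) (c i) := hΓ.dist_triangle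
  rw [hcoord k hk] at h₁
  rw [Γ.dist_comm (v := c 0)] at h₂
  omega

theorem exists_line_near (hn : VertexHyperbolic Γ n) (hΓ : Γ.Connected)
    (hB : BoundedGeometry Γ) (hc : IsLocalGeodesic Γ c (8 * n + 2)) :
    ∃ γ : ℤ → V, IsGeodesicOn Γ γ Set.univ ∧ ∀ i, ∃ k, Γ.dist (c i) (γ k) ≤ 2 * n := by
  choose p hp h₀ hnear using hc.exists_isGeodesicOn_near hn hΓ hB
  have hlarge : ∀ i : ℤ, ∀ᶠ m in hyperfilter ℕ, i.natAbs ≤ m := fun i =>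
    Nat.hyperfilter_le_atTop (eventually_ge_atTop i.natAbs)
  obtain ⟨γ, hγ, hpγ⟩ := exists_limit_geodesic (hyperfilter ℕ) hB.finite_ball hΓ
    (fun i j => ((hlarge i).and (hlarge j)).mono fun m h =>
      hp m i ⟨by omega, by omega⟩ j ⟨by omega, by omega⟩)
    (Eventually.of_forall h₀)
  refine ⟨γ, hγ, fun i => ?_⟩
  have hfinite : {k : ℤ | k.natAbs ≤ 4 * n + Γ.dist (c 0) (c i)}.Finite :=
    (Set.finite_Icc (-(4 * n + Γ.dist (c 0) (c i) : ℤ)) (4 * n + Γ.dist (c 0) (c i))).subset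
      fun k hk => ⟨by grind, by grind⟩
  obtain ⟨k, -, hk⟩ := (Ultrafilter.eventually_exists_mem_iff hfinite).1
    ((hlarge i).mono fun m hm => hnear m i hm)
  obtain ⟨m, hm, hmk⟩ := (hk.and (hpγ k)).exists
  exact ⟨k, hmk ▸ hm⟩

theorem exists_geodesic_line (hn : VertexHyperbolic Γ n) (hΓ : Γ.Connected)
    (hB : BoundedGeometry Γ) (hc : IsLocalGeodesic Γ c (8 * n + 2)) :
    ∃ (γ : ℤ → V) (t : ℤ → ℤ), IsGeodesicOn Γ γ Set.univ ∧
      (∀ i, Γ.dist (c i) (γ (t i)) ≤ 2 * n) ∧ Tendsto t atTop atTop ∧ Tendsto t atBot atBot := by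
  obtain ⟨γ, hγ, hnear⟩ := hc.exists_line_near hn hΓ hB
  choose t ht using hnear
  have hγt : ∀ i j, Γ.dist (γ (t i)) (γ (t j)) = (t j - t i).natAbs := fun i j =>
    hγ _ trivial _ trivial
  have htri : ∀ x y z w, Γ.dist x w ≤ Γ.dist x y + Γ.dist y z + Γ.dist z w := fun x y z w =>
    (hΓ.dist_triangle (v := z)).trans (Nat.add_le_add_right hΓ.dist_triangle _)
  have hstep : ∀ i, |t (i + 1) - t i| ≤ 4 * n + 1 := by
    intro i
    have h := htri (γ (t i)) (c i) (c (i + 1)) (γ (t (i + 1)))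
    rw [hγt, hc (by omega), Γ.dist_comm (v := c i)] at h
    have := ht i
    have := ht (i + 1)
    rw [Int.abs_eq_natAbs]
    omega
  have hproper : ∀ r, ∃ M, ∀ i j, M ≤ j - i → r < |t j - t i| := by
    intro r
    obtain ⟨M, hM⟩ := hc.exists_lt_dist hn hΓ hB (4 * n + r.toNat)
    refine ⟨M, fun i j hij => ?_⟩
    have h := htri (c i) (γ (t i)) (γ (t j)) (c j)
    rw [hγt, Γ.dist_comm (u := γ (t j))] at h
    have := hM i j (by omega)
    have := ht i
    have := ht j
    rw [Int.abs_eq_natAbs]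
    omega
  rcases tendsto_or_tendsto_neg hstep hproper with ⟨htop, hbot⟩ | ⟨htop, hbot⟩
  · exact ⟨γ, t, hγ, ht, htop, hbot⟩
  · exact ⟨fun i => γ (-i), -t, by simpa using hγ.comp_neg, by simpa using ht, htop, hbot⟩

end IsLocalGeodesic

end Line

/-! ### Loxodromic isometries and their axes -/

section Metric

variable {X : Type*} [MetricSpace X]

theorem isGeodesicSegment_image {γ : ℝ → X} (hγ : Isometry γ) {a b : ℝ} (hab : a ≤ b) :
    IsGeodesicSegment (γ a) (γ b) (γ '' Set.Icc a b) := by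
  have hd : dist (γ a) (γ b) = b - a := by
    rw [hγ.dist_eq, dist_comm, Real.dist_eq, abs_of_nonneg (sub_nonneg.2 hab)]
  refine ⟨fun t => γ (t + a), by simp, by simp [hd], fun s _ t _ => ?_, ?_⟩
  · rw [hγ.dist_eq, dist_add_right, Real.dist_eq]
  · rw [hd, ← Set.image_image γ (· + a), Set.image_add_const_Icc, zero_add, sub_add_cancel]

theorem gromovProduct_comm (p x y : X) : gromovProduct p x y = gromovProduct p y x := by
  rw [gromovProduct, gromovProduct, dist_comm x y, add_comm (dist p x)]

theorem IsGeodesicSegment.gromovProduct_le {x y q : X} {σ : Set X} (h : IsGeodesicSegment x y σ)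
    (hq : q ∈ σ) (p : X) : gromovProduct p x y ≤ dist p q := by
  obtain ⟨c, h₀, h₁, hc, rfl⟩ := h
  obtain ⟨t, ht, rfl⟩ := hq
  have hd : 0 ≤ dist x y := dist_nonneg
  have hx := hc t ht 0 ⟨le_rfl, hd⟩
  have hy := hc t ht (dist x y) ⟨hd, le_rfl⟩
  rw [h₀, sub_zero, abs_of_nonneg ht.1] at hx
  rw [h₁, abs_sub_comm, abs_of_nonneg (sub_nonneg.2 ht.2)] at hy
  have := dist_triangle p (c t) x
  have := dist_triangle p (c t) y
  rw [gromovProduct]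
  linarith

theorem tendsto_gromovProduct {ι : Type*} {l : Filter ι} {γ : ℝ → X} (hγ : Isometry γ) {y : ι → X}
    {s : ι → ℝ} {C : ℝ} (hs : Tendsto s l atTop) (hy : ∀ m, dist (y m) (γ (s m)) ≤ C) (p : X) :
    Tendsto (fun q : ℝ × ι => gromovProduct p (γ q.1) (y q.2)) (atTop ×ˢ l) atTop := by
  have hlower : ∀ r m, min r (s m) - dist p (γ 0) - C ≤ gromovProduct p (γ r) (y m) := by
    intro r m
    have hr := dist_triangle (γ 0) p (γ r)
    have hsm := dist_triangle4 (γ 0) p (y m) (γ (s m))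
    have hrs := dist_triangle (γ r) (γ (s m)) (y m)
    rw [hγ.dist_eq, dist_zero_left, Real.norm_eq_abs, dist_comm (γ 0)] at hr hsm
    rw [hγ.dist_eq, Real.dist_eq, dist_comm (γ (s m))] at hrs
    rw [gromovProduct]
    have := le_abs_self r
    have := le_abs_self (s m)
    have := hy m
    rcases le_total r (s m) with h | h
    · rw [abs_of_nonpos (sub_nonpos.2 h)] at hrs
      linarith [min_eq_left h]
    · rw [abs_of_nonneg (sub_nonneg.2 h)] at hrs
      linarith [min_eq_right h]
  refine tendsto_atTop_mono (fun q => hlower q.1 q.2) ?_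
  simp only [sub_eq_add_neg]
  exact tendsto_atTop_add_const_right _ _ (tendsto_atTop_add_const_right _ _
    (tendsto_inf_atTop _ tendsto_fst (hs.comp tendsto_snd)))

theorem IsHyperbolic.nonneg [Nonempty X] {δ : ℝ} (hδ : IsHyperbolic X δ) : 0 ≤ δ := by
  inhabit X
  obtain ⟨σ, hσ⟩ := hδ.1 (default : X) default
  obtain ⟨c, -, -, -, hc⟩ := id hσ
  have hmem : c 0 ∈ σ := hc ▸ Set.mem_image_of_mem c ⟨le_rfl, dist_nonneg⟩
  obtain ⟨q, -, hq⟩ := hδ.2 _ _ _ σ σ σ hσ hσ hσ _ hmem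
  exact dist_nonneg.trans hq

theorem IsHyperbolic.quadrilateral {δ : ℝ} (hδ : IsHyperbolic X δ) {y z a b s p : X} {σ τ : Set X}
    (hσ : IsGeodesicSegment y z σ) (hτ : IsGeodesicSegment b a τ) (hs : s ∈ σ) {C : ℝ}
    (hp : dist p s ≤ C) (hza : C + 2 * δ < gromovProduct p a z)
    (hyb : C + 2 * δ < gromovProduct p b y) : ∃ q ∈ τ, dist p q ≤ C + 2 * δ := by
  obtain ⟨e₁, he₁⟩ := hδ.1 z a
  obtain ⟨e₂, he₂⟩ := hδ.1 a y
  obtain ⟨e₃, he₃⟩ := hδ.1 y b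
  rw [gromovProduct_comm] at hza hyb
  obtain ⟨q, hq, hsq⟩ := hδ.2 _ _ _ _ _ _ hσ he₁ he₂ s hs
  have hδ₀ : 0 ≤ δ := dist_nonneg.trans hsq
  have hpq := dist_triangle p s q
  rcases hq with hq | hq
  · linarith [he₁.gromovProduct_le hq p]
  obtain ⟨r, hr, hqr⟩ := hδ.2 _ _ _ _ _ _ he₂ he₃ hτ q hq
  have hpr := dist_triangle p q r
  rcases hr with hr | hr
  · linarith [he₃.gromovProduct_le hr p]
  · exact ⟨r, hr, by linarith⟩

variable {G : Type*} [Group G] [MulAction G X] {p : X} {g : G}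

theorem actsLoxodromically_of_linear_le [IsIsometricSMul G X] {ε C : ℝ} (hε : 0 < ε)
    (h : ∀ m : ℕ, ε * m - C ≤ dist p (g ^ m • p)) : ActsLoxodromically p g := by
  have hsub : Subadditive fun m : ℕ => dist p (g ^ m • p) := by
    intro k m
    simp only [pow_add, mul_smul]
    exact (dist_triangle p (g ^ k • p) _).trans_eq (by rw [dist_smul])
  have hlim := hsub.tendsto_lim ⟨0, by rintro _ ⟨m, rfl⟩; positivity⟩
  have hlower : Tendsto (fun m : ℕ => ε - C / m) atTop (𝓝 ε) := by
    simpa using (tendsto_const_nhds (x := ε)).sub (tendsto_const_div_atTop_nhds_zero_nat C)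
  refine ⟨_, hε.trans_le (le_of_tendsto_of_tendsto hlower hlim ?_), hlim⟩
  filter_upwards [eventually_gt_atTop 0] with m hm
  have hm₀ : (0 : ℝ) < m := mod_cast hm
  rw [le_div_iff₀ hm₀, sub_mul, div_mul_cancel₀ _ hm₀.ne']
  exact h m

theorem ActsLoxodromically.not_isOfFinOrder (h : ActsLoxodromically p g) : ¬ IsOfFinOrder g := by
  obtain ⟨τ, hτ, hlim⟩ := h
  intro hg
  obtain ⟨m, hm, hgm⟩ := hg.exists_pow_eq_one
  have hmultiples := hlim.comp (tendsto_id.const_mul_atTop' hm)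
  simp only [Function.comp_def, id, pow_mul, hgm, one_pow, one_smul, dist_self,
    zero_div] at hmultiples
  exact hτ.ne (tendsto_nhds_unique tendsto_const_nhds hmultiples)

theorem isAxis_of_dist_le {γ : ℝ → X} (hγ : Isometry γ) {t : ℤ → ℝ} {C : ℝ}
    (hC : ∀ k, dist (g ^ k • p) (γ (t k)) ≤ C) (htop : Tendsto t atTop atTop)
    (hbot : Tendsto t atBot atBot) : IsAxis p g γ := by
  have hneg : Tendsto (fun m : ℕ => -t (-m)) atTop atTop :=
    tendsto_neg_atBot_atTop.comp
      (hbot.comp (tendsto_neg_atTop_atBot.comp tendsto_natCast_atTop_atTop))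
  have hreverse : Isometry fun r : ℝ => γ (-r) := hγ.comp (IsometryEquiv.neg ℝ).isometry
  have hback : ∀ m : ℕ, dist (g⁻¹ ^ m • p) (γ (- -t (-m))) ≤ C := fun m => by
    simpa using hC (-m)
  refine ⟨hγ, ?_, ?_⟩
  · exact tendsto_gromovProduct hγ (htop.comp tendsto_natCast_atTop_atTop)
      (fun m => by simpa using hC m) p
  · exact tendsto_gromovProduct hreverse hneg hback p

theorem IsHyperbolic.exists_dist_axis_le {δ C : ℝ} (hδ : IsHyperbolic X δ)
    (hC : ∀ m : ℕ, ∃ σ, IsGeodesicSegment (g⁻¹ ^ m • p) (g ^ m • p) σ ∧ ∃ s ∈ σ, dist p s ≤ C)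
    {γ : ℝ → X} (hγ : IsAxis p g γ) : ∃ t, dist p (γ t) ≤ C + 2 * δ := by
  obtain ⟨hiso, htop, hbot⟩ := hγ
  obtain ⟨⟨T, m⟩, hT, hm, hm'⟩ := ((eventually_ge_atTop (0 : ℝ)).prod_inl atTop |>.and
    ((htop.eventually_gt_atTop (C + 2 * δ)).and (hbot.eventually_gt_atTop (C + 2 * δ)))).exists
  obtain ⟨σ, hσ, s, hs, hps⟩ := hC m
  have hab : -T ≤ T := neg_le_self hT
  obtain ⟨-, ⟨t, -, rfl⟩, ht⟩ :=
    hδ.quadrilateral hσ (isGeodesicSegment_image hiso hab) hs hps hm hm'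
  exact ⟨t, ht⟩

end Metric

/-! ### Words and geodesics in Cayley graphs -/

section Cayley

open SimpleGraph (mulCayley mulCayley_adj mulCayley_adj_mul_iff_right)

variable {G : Type*} [Group G] {S : Set G} {hS : Subgroup.closure S = ⊤}

theorem Realization.IsChain.smul (g : G) {x y : CayleySpace S hS} {a : ℝ} (h : IsChain x y a) :
    IsChain (g • x) (g • y) a := by
  induction h with
  | nil x => exact .nil _
  | cons u v huv s t hs ht x y z hx hy ℓ _ ih =>
    have hsmul : ∀ {x : CayleySpace S hS} {r : ℝ}, x.coord = edgeCoord u v r →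
        (g • x).coord = edgeCoord (g * u) (g * v) r := fun {x r} h => by
      funext w
      rw [← edgeCoord_mul, ← h]
      rfl
    exact .cons _ _ (mulCayley_adj_mul_iff_right.2 huv) s t hs ht _ _ _ (hsmul hx) (hsmul hy) ℓ ih

instance : IsIsometricSMul G (CayleySpace S hS) where
  isometry_smul g := by
    have hle : ∀ (g : G) (x y : CayleySpace S hS), dist (g • x) (g • y) ≤ dist x y :=
      fun g x y => csInf_le_csInf (Realization.bddBelow_chain _ _) (Realization.exists_chain x y)
        fun _ h => h.smul g
    refine Isometry.of_dist_eq fun x y => (hle g x y).antisymm ?_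
    simpa using hle g⁻¹ (g • x) (g • y)

theorem smul_cayleyVertex (g u : G) : g • cayleyVertex S hS u = cayleyVertex S hS (g * u) :=
  Realization.coord_injective (funext (edgeCoord_mul g u u 0))

theorem dist_cayleyVertex (u v : G) :
    dist (cayleyVertex S hS u) (cayleyVertex S hS v) = (mulCayley S).dist u v :=
  Realization.dist_vertex u v

theorem dist_mul_left_mulCayley (hS : Subgroup.closure S = ⊤) (g u v : G) :
    (mulCayley S).dist (g * u) (g * v) = (mulCayley S).dist u v := by
  have h := dist_smul g (cayleyVertex S hS u) (cayleyVertex S hS v)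
  rw [smul_cayleyVertex, smul_cayleyVertex, dist_cayleyVertex, dist_cayleyVertex] at h
  exact_mod_cast h

theorem dist_self_mul_mulCayley (hS : Subgroup.closure S = ⊤) (g u : G) :
    (mulCayley S).dist g (g * u) = (mulCayley S).dist 1 u := by
  simpa using dist_mul_left_mulCayley hS g 1 u

/-- All letters of the word `w` are in `S ∪ S⁻¹`. -/
def IsWord (S : Set G) (w : List G) : Prop := ∀ a ∈ w, a ∈ S ∨ a⁻¹ ∈ S

theorem IsWord.of_infix {v w : List G} (hw : IsWord S w) (hv : v <:+: w) : IsWord S v :=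
  fun a ha => hw a (hv.subset ha)

theorem finite_isWord (hfin : S.Finite) (k : ℕ) :
    {w : List G | IsWord S w ∧ w.length ≤ k}.Finite := by
  have : Finite {a : G | a ∈ S ∨ a⁻¹ ∈ S} := (hfin.union hfin.inv).to_subtype
  refine ((List.finite_length_le {a : G | a ∈ S ∨ a⁻¹ ∈ S} k).image
    (List.map Subtype.val)).subset ?_
  rintro w ⟨hw, hk⟩
  lift w to List {a : G | a ∈ S ∨ a⁻¹ ∈ S} using hw
  exact ⟨w, (List.length_map _).symm.trans_le hk, rfl⟩

theorem IsWord.dist_mul_prod_le (hS : Subgroup.closure S = ⊤) {w : List G} (hw : IsWord S w)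
    (g : G) : (mulCayley S).dist g (g * w.prod) ≤ w.length := by
  induction w generalizing g with
  | nil => simp
  | cons a w ih =>
    have hletter : (mulCayley S).dist g (g * a) ≤ 1 := by
      rcases eq_or_ne a 1 with rfl | ha
      · simp
      · refine (SimpleGraph.dist_eq_one_iff_adj.2 ((mulCayley_adj S _ _).2 ⟨?_, ?_⟩)).le
        · simpa using ha
        · simpa using hw a (by simp)
    have htail := ih (fun b hb => hw b (by simp [hb])) (g * a)
    have htriangle := (cayley_connected hS).dist_triangle (u := g) (v := g * a)
      (w := g * a * w.prod)
    rw [List.prod_cons, List.length_cons, ← mul_assoc]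
    omega

theorem isGeodesicWord_iff {w : List G} :
    IsGeodesicWord S hS w ↔ (mulCayley S).dist 1 w.prod = w.length := by
  rw [IsGeodesicWord, dist_cayleyVertex, Nat.cast_inj]

theorem IsGeodesicWord.of_infix {v w : List G} (h : IsGeodesicWord S hS w) (hw : IsWord S w)
    (hv : v <:+: w) : IsGeodesicWord S hS v := by
  have hle := (hw.of_infix hv).dist_mul_prod_le hS 1
  rw [isGeodesicWord_iff] at h ⊢
  obtain ⟨s, t, rfl⟩ := hv
  have hs := IsWord.dist_mul_prod_le hS (w := s) (fun a ha => hw a (by simp [ha])) 1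
  have ht := IsWord.dist_mul_prod_le hS (w := t) (fun a ha => hw a (by simp [ha]))
    (s.prod * v.prod)
  have hconn := cayley_connected hS
  have hst := hconn.dist_triangle (u := 1) (v := s.prod * v.prod)
    (w := s.prod * v.prod * t.prod)
  have hsv := hconn.dist_triangle (u := 1) (v := s.prod) (w := s.prod * v.prod)
  rw [dist_self_mul_mulCayley hS s.prod] at hsv
  simp only [List.prod_append, List.length_append] at h
  rw [one_mul] at hle hs
  omega

theorem exists_isWord_of_walk {u v : G} (p : (mulCayley S).Walk u v) :
    ∃ w, IsWord S w ∧ u * w.prod = v ∧ w.length = p.length := by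
  induction p with
  | nil => exact ⟨[], by simp [IsWord], by simp, rfl⟩
  | @cons u v x huv p ih =>
    obtain ⟨w, hw, hprod, hlen⟩ := ih
    refine ⟨u⁻¹ * v :: w, ?_, by simp [mul_assoc, hprod], by simp [hlen]⟩
    intro a ha
    rcases List.mem_cons.1 ha with rfl | ha
    · simpa using ((mulCayley_adj S _ _).1 huv).2
    · exact hw a ha

theorem exists_isGeodesicWord (hS : Subgroup.closure S = ⊤) (g : G) :
    ∃ w, IsWord S w ∧ w.prod = g ∧ IsGeodesicWord S hS w := by
  obtain ⟨p, hp⟩ := (cayley_connected hS).exists_walk_length_eq_dist 1 g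
  obtain ⟨w, hw, hprod, hlen⟩ := exists_isWord_of_walk p
  rw [one_mul] at hprod
  exact ⟨w, hw, hprod, isGeodesicWord_iff.2 (by rw [hprod, hlen, hp])⟩

theorem boundedGeometry_mulCayley (hS : Subgroup.closure S = ⊤) (hfin : S.Finite) :
    BoundedGeometry (mulCayley S) := by
  intro r
  have hwords := finite_isWord hfin r
  refine ⟨{w : List G | IsWord S w ∧ w.length ≤ r}.ncard, fun v => ?_⟩
  rw [hwords.cast_ncard_eq]
  refine (Set.encard_le_encard ?_).trans (Set.encard_image_le (fun w => v * w.prod) _)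
  intro x hx
  obtain ⟨w, hw, hprod, hgeo⟩ := exists_isGeodesicWord hS (v⁻¹ * x)
  refine ⟨w, ⟨hw, ?_⟩, by simp [hprod]⟩
  rw [← isGeodesicWord_iff.1 hgeo, hprod, ← dist_self_mul_mulCayley hS v]
  simpa using hx

end Cayley

section Periodic

open SimpleGraph (mulCayley)

variable {G : Type*} [Group G]

/-- `c` is an `N`-local geodesic through `1` that the left multiplication by `g` shifts by `ℓ`. -/
structure IsPeriodicGeodesic (Γ : SimpleGraph G) (N : ℕ) (g : G) (c : ℤ → G) (ℓ : ℤ) : Prop where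
  isLocalGeodesic : IsLocalGeodesic Γ c N
  apply_zero : c 0 = 1
  apply_add : ∀ i, c (i + ℓ) = g * c i
  period_pos : 0 < ℓ

namespace IsPeriodicGeodesic

variable {g : G} {c : ℤ → G} {ℓ : ℤ}

theorem apply_mul_period {Γ : SimpleGraph G} {N : ℕ} (hc : IsPeriodicGeodesic Γ N g c ℓ) (k : ℤ) :
    c (k * ℓ) = g ^ k := by
  have hstep : ∀ k, c ((k + 1) * ℓ) = g * c (k * ℓ) := fun k => by
    rw [add_mul, one_mul, hc.apply_add]
  induction k with
  | zero => simpa using hc.apply_zero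
  | succ k ih => rw [hstep, ih, add_comm, zpow_one_add]
  | pred k ih =>
    have h := hstep (-k - 1)
    rw [sub_add_cancel, ih] at h
    refine mul_left_cancel (a := g) ?_
    rw [← h, ← zpow_one_add, add_sub_cancel]

variable {S : Set G} {hS : Subgroup.closure S = ⊤} {δ : ℝ}

theorem actsLoxodromically (hfin : S.Finite) (hδ : IsHyperbolic (CayleySpace S hS) δ)
    (hc : IsPeriodicGeodesic (mulCayley S) (8 * ⌊δ⌋₊ + 2) g c ℓ) :
    ActsLoxodromically (cayleyVertex S hS 1) g := by
  obtain ⟨B, hB⟩ := boundedGeometry_mulCayley hS hfin (2 * ⌊δ⌋₊)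
  have hlinear : ∀ m : ℕ, m < B * ((mulCayley S).dist 1 (g ^ m) + 1) := by
    intro m
    have h := hc.isLocalGeodesic.natAbs_sub_lt hδ.vertexHyperbolic (cayley_connected hS) hB
      0 (m * ℓ)
    rw [hc.apply_zero, hc.apply_mul_period, zpow_natCast, sub_zero, Int.natAbs_mul,
      Int.natAbs_natCast] at h
    exact (Nat.le_mul_of_pos_right m (Int.natAbs_pos.2 hc.period_pos.ne')).trans_lt h
  have hBpos : (0 : ℝ) < B := mod_cast Nat.pos_of_mul_pos_right (hlinear 0)
  refine actsLoxodromically_of_linear_le (ε := 1 / B) (C := 1) (by positivity) fun m => ?_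
  rw [smul_cayleyVertex, mul_one, dist_cayleyVertex, one_div_mul_eq_div, sub_le_iff_le_add,
    div_le_iff₀' hBpos]
  exact_mod_cast (hlinear m).le

theorem exists_isAxis (hfin : S.Finite) (hδ : IsHyperbolic (CayleySpace S hS) δ)
    (hc : IsPeriodicGeodesic (mulCayley S) (8 * ⌊δ⌋₊ + 2) g c ℓ) :
    ∃ γ : ℝ → CayleySpace S hS, IsAxis (cayleyVertex S hS 1) g γ := by
  obtain ⟨γ, t, hγ, hclose, htop, hbot⟩ := hc.isLocalGeodesic.exists_geodesic_line
    hδ.vertexHyperbolic (cayley_connected hS) (boundedGeometry_mulCayley hS hfin)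
  have hisometry : Isometry (Realization.path γ : ℝ → CayleySpace S hS) :=
    Realization.isometry_path hγ
  have htop' : Tendsto (fun k => (t (k * ℓ) : ℝ)) atTop atTop :=
    tendsto_intCast_atTop_iff.2 (htop.comp (tendsto_id.atTop_mul_const' hc.period_pos))
  have hbot' : Tendsto (fun k => (t (k * ℓ) : ℝ)) atBot atBot :=
    tendsto_intCast_atBot_iff.2 (hbot.comp (tendsto_id.atBot_mul_const' hc.period_pos))
  refine ⟨_, isAxis_of_dist_le (C := 2 * ⌊δ⌋₊) hisometry (fun k => ?_) htop' hbot'⟩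
  rw [smul_cayleyVertex, mul_one, ← hc.apply_mul_period, Realization.path_intCast]
  exact (dist_cayleyVertex _ _).trans_le (mod_cast hclose (k * ℓ))

theorem exists_dist_axis_le (hδ : IsHyperbolic (CayleySpace S hS) δ)
    (hc : IsPeriodicGeodesic (mulCayley S) (8 * ⌊δ⌋₊ + 2) g c ℓ) {γ : ℝ → CayleySpace S hS}
    (hγ : IsAxis (cayleyVertex S hS 1) g γ) :
    ∃ t, dist (cayleyVertex S hS 1) (γ t) ≤ 4 * δ := by
  have : Nonempty (CayleySpace S hS) := ⟨cayleyVertex S hS 1⟩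
  suffices h : ∃ t, dist (cayleyVertex S hS 1) (γ t) ≤ 2 * ⌊δ⌋₊ + 2 * δ by
    obtain ⟨t, ht⟩ := h
    exact ⟨t, by linarith [Nat.floor_le hδ.nonneg]⟩
  refine hδ.exists_dist_axis_le (fun m => ?_) hγ
  obtain ⟨p, hp, hp₀, hp₁⟩ := exists_isGeodesicOn (cayley_connected hS) (c (-m * ℓ)) (c (m * ℓ))
  rw [← Set.uIcc_of_le (by omega)] at hp
  have hℓ := hc.period_pos
  obtain ⟨k, hk, hdist⟩ := hc.isLocalGeodesic.exists_dist_le hδ.vertexHyperbolic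
    (cayley_connected hS) hp hp₀ hp₁ (i := 0) ⟨by nlinarith, by positivity⟩
  have hsegment := Realization.isGeodesicSegment_path (hΓ := cayley_connected hS) hp
  have hends : ∀ k : ℤ, (Realization.vertex (c (k * ℓ)) : CayleySpace S hS) =
      g ^ k • cayleyVertex S hS 1 := fun k => by
    rw [smul_cayleyVertex, mul_one, hc.apply_mul_period, cayleyVertex]
  rw [hp₀, hp₁, hends, hends, zpow_neg, zpow_natCast, ← inv_pow] at hsegment
  refine ⟨_, hsegment, _, Realization.vertex_mem_path_image hk, ?_⟩
  rw [hc.apply_zero] at hdist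
  exact (dist_cayleyVertex _ _).trans_le (mod_cast hdist)

end IsPeriodicGeodesic

end Periodic

/-! ### Closing up words -/

section Words

open SimpleGraph (mulCayley)

variable {G : Type*} [Group G] {S : Set G} {hS : Subgroup.closure S = ⊤}

/-- The vertices, indexed by `ℤ`, of the bi-infinite path through `1` labelled by the periodic
word `…ppp…`: its vertex of index `q * p.length + r` with `0 ≤ r < p.length` is the product of
`p ^ q` and the first `r` letters of `p`. -/
def wordLine (p : List G) (i : ℤ) : G :=
  p.prod ^ (i / p.length) * (p.take (i % p.length).toNat).prod

theorem wordLine_zero (p : List G) : wordLine p 0 = 1 := by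
  simp [wordLine]

theorem wordLine_add_length {p : List G} (hp : p ≠ []) (i : ℤ) :
    wordLine p (i + p.length) = p.prod * wordLine p i := by
  have hlen : (p.length : ℤ) ≠ 0 := by simpa using hp
  rw [wordLine, Int.add_ediv_of_dvd_right dvd_rfl, Int.ediv_self hlen, Int.add_emod_right,
    add_comm, zpow_one_add, mul_assoc, wordLine]

theorem wordLine_mul_length_add {p : List G} {r : ℕ} (hr : r < p.length) (q : ℤ) :
    wordLine p (q * p.length + r) = p.prod ^ q * (p.take r).prod := by
  have hr' : (r : ℤ) < p.length := mod_cast hr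
  rw [wordLine, add_comm, Int.add_mul_ediv_right _ _ (by omega), Int.add_mul_emod_self_right,
    Int.ediv_eq_zero_of_lt (by omega) hr', Int.emod_eq_of_lt (by omega) hr', zero_add,
    Int.toNat_natCast]

theorem wordLine_mul_length_add_of_prefix {p v : List G} (hv : v <+: p) {r : ℕ}
    (hr : r < p.length + v.length) (q : ℤ) :
    wordLine p (q * p.length + r) = p.prod ^ q * ((p ++ v).take r).prod := by
  rcases lt_or_ge r p.length with hrp | hrp
  · rw [wordLine_mul_length_add hrp, List.take_append_of_le_length hrp.le]
  · obtain ⟨s, rfl⟩ := Nat.exists_eq_add_of_le hrp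
    obtain ⟨u, rfl⟩ := hv
    have hsv : s < v.length := by omega
    have hs : s < (v ++ u).length := hsv.trans_le (by simp)
    have hindex : q * ((v ++ u).length : ℤ) + ((v ++ u).length + s : ℕ) =
        (q + 1) * (v ++ u).length + s := by push_cast; ring
    rw [hindex, wordLine_mul_length_add hs, List.take_append_of_le_length hsv.le,
      List.take_length_add_append, List.prod_append (l₁ := v ++ u), zpow_add_one, mul_assoc]

theorem isPeriodicGeodesic_wordLine {p v : List G} (hv : v <+: p) {N : ℕ} (hN : 0 < N)
    (hNv : N ≤ v.length) (h : ∀ u, u <:+: p ++ v → u.length ≤ N → IsGeodesicWord S hS u) :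
    IsPeriodicGeodesic (mulCayley S) N p.prod (wordLine p) p.length := by
  have hlen : 0 < p.length := hN.trans_le (hNv.trans hv.length_le)
  refine ⟨isLocalGeodesic_of_dist_add fun i m hm => ?_, wordLine_zero p,
    wordLine_add_length (List.ne_nil_of_length_pos hlen), mod_cast hlen⟩
  obtain ⟨r, hr⟩ := Int.eq_ofNat_of_zero_le (Int.emod_nonneg i (b := p.length) (by omega))
  have hmod := Int.emod_lt_of_pos i (b := p.length) (by omega)
  have hi : i = i / p.length * p.length + r := by rw [← hr, mul_comm, Int.mul_ediv_add_emod]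
  have hstart := wordLine_mul_length_add_of_prefix hv (r := r) (by omega) (i / p.length)
  have hend := wordLine_mul_length_add_of_prefix hv (r := r + m) (by omega) (i / p.length)
  rw [← hi] at hstart
  rw [Nat.cast_add, ← add_assoc, ← hi, List.take_add, List.prod_append, ← mul_assoc,
    ← hstart] at hend
  have hsub : ((p ++ v).drop r).take m <:+: p ++ v :=
    (List.take_prefix _ _).isInfix.trans (List.drop_suffix _ _).isInfix
  have hsublen : (((p ++ v).drop r).take m).length = m := by
    rw [List.length_take, List.length_drop, List.length_append]
    omega
  rw [hend, dist_self_mul_mulCayley hS, isGeodesicWord_iff.1 (h _ hsub (by omega)), hsublen]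

theorem infix_append_or_infix_append {α : Type*} {u x y z : List α} (hu : u <:+: x ++ y ++ z)
    (hlen : u.length ≤ y.length) : u <:+: x ++ y ∨ u <:+: y ++ z := by
  rw [List.append_assoc, List.infix_append_iff] at hu
  rcases hu with hux | huyz | ⟨u₁, u₂, rfl, hu₁, hu₂⟩
  · exact .inl (hux.trans (List.prefix_append _ _).isInfix)
  · exact .inr huyz
  · rw [List.length_append] at hlen
    have hu₂y : u₂ <+: y :=
      List.prefix_of_prefix_length_le hu₂ (List.prefix_append _ _) (by omega)
    obtain ⟨s, rfl⟩ := hu₁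
    obtain ⟨t, rfl⟩ := hu₂y
    exact .inl ⟨s, t, by simp⟩

/-- Every geodesic word `w` of length at least `N` is closed up by some word `f` of length at most
`D` to a cyclic word `w ++ f` whose subwords of length at most `N` through the junctions with `f`
are geodesic. As `N ≤ w.length`, it suffices to look at subwords of `w ++ f ++ w`. -/
def HasClosings (S : Set G) (hS : Subgroup.closure S = ⊤) (N D : ℕ) : Prop :=
  ∀ w, IsWord S w → IsGeodesicWord S hS w → N ≤ w.length →
    ∃ f, IsWord S f ∧ f.length ≤ D ∧
      ∀ u, u <:+: w ++ f ++ w → u.length ≤ N → IsGeodesicWord S hS u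

theorem HasClosings.exists_isPeriodicGeodesic {N D : ℕ} (h : HasClosings S hS N D) (hN : 0 < N)
    {g : G} (hg : N ≤ (mulCayley S).dist 1 g) :
    ∃ g' c ℓ, (mulCayley S).dist g g' ≤ D ∧ IsPeriodicGeodesic (mulCayley S) N g' c ℓ := by
  obtain ⟨w, hw, rfl, hgeo⟩ := exists_isGeodesicWord hS g
  rw [isGeodesicWord_iff.1 hgeo] at hg
  obtain ⟨f, hf, hfD, hsub⟩ := h w hw hgeo hg
  refine ⟨_, _, _, ?_, isPeriodicGeodesic_wordLine (List.prefix_append w f) hN hg hsub⟩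
  rw [List.prod_append]
  exact (hf.dist_mul_prod_le hS _).trans hfD

theorem exists_hasClosings (hfin : S.Finite) {k : ℝ} (hk : 0 ≤ k)
    (hconcat : ConcatenationHypothesis (localGeodesics S hS k)) :
    ∃ D, HasClosings S hS ⌊k⌋₊ D := by
  set N := ⌊k⌋₊
  unfold ConcatenationHypothesis at hconcat
  choose! F hF hjoin using hconcat
  have hfinite := finite_isWord hfin N
  obtain ⟨D, hD⟩ := ((hfinite.prod hfinite).image fun q => (F q.1 q.2).length).bddAbove
  refine ⟨D, fun w hw hgeo hNw => ?_⟩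
  have hmem : ∀ {u}, u <:+: w → u ∈ localGeodesics S hS k := fun hu =>
    ⟨hw.of_infix hu, fun v hv _ => hgeo.of_infix hw (hv.trans hu)⟩
  obtain ⟨a, b, rfl, hb⟩ : ∃ a b, w = a ++ b ∧ b.length = N :=
    ⟨_, _, (List.take_append_drop (w.length - N) w).symm, by rw [List.length_drop]; omega⟩
  obtain ⟨c, d, hcd, hc⟩ : ∃ c d, a ++ b = c ++ d ∧ c.length = N :=
    ⟨_, _, (List.take_append_drop N (a ++ b)).symm, by rw [List.length_take]; omega⟩
  have hbw : b <:+: a ++ b := (List.suffix_append a b).isInfix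
  have hcw : c <:+: a ++ b := hcd ▸ (List.prefix_append c d).isInfix
  have hF' := hF b (hmem hbw) c (hmem hcw)
  refine ⟨F b c, hF'.1, hD ⟨(b, c), ⟨⟨hw.of_infix hbw, hb.le⟩, hw.of_infix hcw, hc.le⟩, rfl⟩, ?_⟩
  intro u hu huN
  have hu' : u <:+: a ++ b ++ (F b c ++ c ++ d) := by
    rwa [List.append_assoc _ c d, ← hcd, ← List.append_assoc (a ++ b)]
  rcases infix_append_or_infix_append hu' (huN.trans hb.ge) with hu | hu
  · exact hgeo.of_infix hw hu
  rw [← List.append_assoc, ← List.append_assoc] at hu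
  rcases infix_append_or_infix_append hu (huN.trans hc.ge) with hu | hu
  · exact (hjoin b (hmem hbw) c (hmem hcw)).2 u hu ((Nat.le_floor_iff hk).1 huN)
  · exact hgeo.of_infix hw (hcd ▸ hu)

end Words

/-! ### Small hyperbolicity constants -/

section TriangleFree

open SimpleGraph (mulCayley mulCayley_adj)

theorem Realization.isGeodesicSegment_edge {V : Type*} {Γ : SimpleGraph V} {hΓ : Γ.Connected}
    {u v : V} (huv : Γ.Adj u v) :
    IsGeodesicSegment (vertex u : Realization Γ hΓ) (vertex v)
      {q | ∃ t ∈ Set.Icc (0 : ℝ) 1, q.coord = edgeCoord u v t} := by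
  obtain ⟨p, hp, rfl, hv⟩ := exists_isGeodesicOn hΓ u v
  rw [SimpleGraph.dist_eq_one_iff_adj.2 huv, Nat.cast_one] at hp hv
  subst hv
  have hcoord : ∀ t ∈ Set.Icc (0 : ℝ) 1,
      (path p t : Realization Γ hΓ).coord = edgeCoord (p 0) (p 1) t := fun t ht => by
    simpa using coord_path (hΓ := hΓ) (i := 0) huv (by simpa using ht)
  rw [← Set.uIcc_of_le zero_le_one] at hp
  convert isGeodesicSegment_path (hΓ := hΓ) hp using 1
  rw [Int.cast_zero, Int.cast_one, Set.uIcc_of_le zero_le_one]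
  ext q
  refine exists_congr fun t => and_congr_right fun ht => ?_
  rw [← hcoord t ht]
  exact ⟨fun h => (coord_injective h).symm, fun h => h ▸ rfl⟩

theorem IsHyperbolic.not_adj_of_lt_half {V : Type*} {Γ : SimpleGraph V} {hΓ : Γ.Connected}
    {δ : ℝ} (hδ : IsHyperbolic (Realization Γ hΓ) δ) (hlt : δ < 1 / 2) {u v w : V}
    (huv : Γ.Adj u v) (hvw : Γ.Adj v w) : ¬ Γ.Adj w u := by
  intro hwu
  let m : Realization Γ hΓ :=
    ⟨edgeCoord u v (1 / 2), u, v, .inr huv, 1 / 2, by norm_num, rfl⟩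
  obtain ⟨q, ⟨t, -, ht⟩ | ⟨t, -, ht⟩, hmq⟩ := hδ.2 _ _ _ _ _ _
    (Realization.isGeodesicSegment_edge huv) (Realization.isGeodesicSegment_edge hvw)
    (Realization.isGeodesicSegment_edge hwu) m ⟨1 / 2, by norm_num, rfl⟩
  · have hdist := Realization.abs_interp_dist_sub_le u m q
    rw [Realization.interp_of_coord _ ht, Realization.interp_of_coord _ rfl, SimpleGraph.dist_self,
      SimpleGraph.dist_eq_one_iff_adj.2 huv, SimpleGraph.dist_eq_one_iff_adj.2 hwu.symm] at hdist
    norm_num at hdist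
    linarith
  · have hdist := Realization.abs_interp_dist_sub_le v m q
    rw [Realization.interp_of_coord _ ht, Realization.interp_of_coord _ rfl, SimpleGraph.dist_self,
      SimpleGraph.dist_eq_one_iff_adj.2 huv.symm, SimpleGraph.dist_eq_one_iff_adj.2 hvw] at hdist
    norm_num at hdist
    linarith

theorem exists_pair_infix {α : Type*} {p : α → Prop} {s x : α} {w : List α} (hs : p s)
    (hxw : x ∈ w) (hx : ¬ p x) : ∃ a b, [a, b] <:+: s :: w ∧ p a ∧ ¬ p b := by
  induction w generalizing s with
  | nil => simp at hxw
  | cons b w ih =>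
    by_cases hb : p b
    · obtain ⟨a, c, hac, h⟩ := ih hb ((List.mem_cons.1 hxw).resolve_left fun h => hx (h ▸ hb))
      exact ⟨a, c, hac.trans (List.suffix_cons s _).isInfix, h⟩
    · exact ⟨s, b, (List.prefix_append [s, b] w).isInfix, hs, hb⟩

variable {G : Type*} [Group G] {S : Set G} {hS : Subgroup.closure S = ⊤} {v w : List G}

/-- The word `w` in the letters `S ∪ S⁻¹` contains neither trivial letters nor consecutive letters
that cancel. -/
structure IsReducedWord (S : Set G) (w : List G) : Prop where
  isWord : IsWord S w
  ne_one : ∀ a ∈ w, a ≠ 1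
  isChain : w.IsChain (fun a b => a * b ≠ 1)

theorem IsReducedWord.of_infix (hw : IsReducedWord S w) (hv : v <:+: w) : IsReducedWord S v :=
  ⟨hw.isWord.of_infix hv, fun a ha => hw.ne_one a (hv.subset ha), hw.isChain.infix hv⟩

theorem IsReducedWord.mul_ne_one (hw : IsReducedWord S w) {a b : G} (hab : [a, b] <:+: w) :
    a * b ≠ 1 := by
  simpa using (hw.of_infix hab).isChain

theorem IsReducedWord.append (hv : IsReducedWord S v) (hw : IsReducedWord S w)
    (h : ∀ a ∈ v.getLast?, ∀ b ∈ w.head?, a * b ≠ 1) : IsReducedWord S (v ++ w) where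
  isWord := List.forall_mem_append.2 ⟨hv.isWord, hw.isWord⟩
  ne_one := List.forall_mem_append.2 ⟨hv.ne_one, hw.ne_one⟩
  isChain := List.isChain_append.2 ⟨hv.isChain, hw.isChain, h⟩

theorem IsGeodesicWord.isReducedWord (h : IsGeodesicWord S hS w) (hw : IsWord S w) :
    IsReducedWord S w where
  isWord := hw
  ne_one := by
    rintro a ha rfl
    have hletter := isGeodesicWord_iff.1 (h.of_infix hw (List.singleton_infix_iff 1 w |>.2 ha))
    simp at hletter
  isChain := by
    rw [List.isChain_iff_forall_rel_of_append_cons_cons]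
    intro a b l₁ l₂ hl hab
    have hpair := isGeodesicWord_iff.1 (h.of_infix hw (v := [a, b]) ⟨l₁, l₂, by simp [hl]⟩)
    simp [hab] at hpair

theorem IsReducedWord.adj (hw : IsReducedWord S w) {a : G} (ha : a ∈ w) (g : G) :
    (mulCayley S).Adj g (g * a) := by
  rw [mulCayley_adj]
  exact ⟨by simpa using hw.ne_one a ha, by simpa using hw.isWord a ha⟩

theorem IsReducedWord.isGeodesicWord {δ : ℝ} (hw : IsReducedWord S w)
    (hδ : IsHyperbolic (CayleySpace S hS) δ) (hlt : δ < 1 / 2) (hlen : w.length ≤ 2) :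
    IsGeodesicWord S hS w := by
  rw [isGeodesicWord_iff]
  match w, hw, hlen with
  | [], _, _ => simp
  | [a], hw, _ => simpa using hw.adj (List.mem_singleton_self a) 1
  | [a, b], hw, _ =>
    have ha : (mulCayley S).Adj 1 a := by simpa using hw.adj (by simp) 1 (a := a)
    have hb : (mulCayley S).Adj a (a * b) := hw.adj (by simp) a
    have hab : ¬ (mulCayley S).Adj 1 (a * b) := fun h => hδ.not_adj_of_lt_half hlt ha hb h.symm
    have hlower := (cayley_connected hS).one_lt_dist_of_ne_of_not_adj
      (hw.mul_ne_one List.infix_rfl).symm hab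
    have hupper := hw.isWord.dist_mul_prod_le hS 1
    simp only [List.prod_cons, List.prod_nil, mul_one, one_mul, List.length_cons,
      List.length_nil] at hupper ⊢
    omega

theorem IsReducedWord.exists_closing (hw : IsReducedWord S w) (hlen : 2 ≤ w.length) :
    ∃ f : List G, f.length ≤ 1 ∧ IsReducedWord S (w ++ f ++ w) := by
  obtain ⟨s, b, l, rfl⟩ : ∃ s b l, w = s :: b :: l := by
    match w, hlen with
    | s :: b :: l, _ => exact ⟨s, b, l, rfl⟩
  obtain ⟨u, hu⟩ : ∃ u, (s :: b :: l).getLast? = some u := ⟨_, List.getLast?_cons⟩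
  by_cases hus : u * s = 1
  · obtain ⟨x, hx, hxs⟩ : ∃ x ∈ b :: l, x ≠ s := by
      by_contra! hall
      have hmem : u ∈ b :: l := by
        rw [List.getLast?_cons_cons] at hu
        exact List.mem_of_getLast? hu
      have hsb := hw.mul_ne_one (List.prefix_append [s, b] l).isInfix
      rw [hall u hmem] at hus
      rw [hall b (by simp)] at hsb
      exact hsb hus
    obtain ⟨_, t, hst, rfl, hts⟩ := exists_pair_infix (p := (· = s)) rfl hx hxs
    have ht : IsReducedWord S [t] := hw.of_infix ((List.suffix_cons _ [t]).isInfix.trans hst)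
    have hst' := hw.mul_ne_one hst
    refine ⟨[t], le_rfl, (hw.append ht ?_).append hw ?_⟩
    · simp only [hu, Option.mem_def, Option.some.injEq, List.head?_cons]
      rintro _ rfl _ rfl hut
      exact hts (mul_left_cancel (hut.trans hus.symm))
    · simp only [Option.mem_def, List.head?_cons, List.getLast?_concat, Option.some.injEq]
      rintro _ rfl _ rfl hts'
      exact hst' (mul_eq_one_comm.1 hts')
  · refine ⟨[], zero_le_one, ?_⟩
    rw [List.append_nil]
    refine hw.append hw ?_
    simp only [hu, Option.mem_def, List.head?_cons, Option.some.injEq]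
    rintro _ rfl _ rfl
    exact hus

theorem hasClosings_of_lt_half {δ : ℝ} (hδ : IsHyperbolic (CayleySpace S hS) δ)
    (hlt : δ < 1 / 2) : HasClosings S hS 2 1 := by
  intro w hw hgeo hlen
  obtain ⟨f, hf, hclosed⟩ := (hgeo.isReducedWord hw).exists_closing hlen
  have hfw : f <:+: w ++ f ++ w := ⟨w, w, rfl⟩
  exact ⟨f, hclosed.isWord.of_infix hfw, hf,
    fun u hu hu₂ => (hclosed.of_infix hu).isGeodesicWord hδ hlt hu₂⟩

end TriangleFree

section Main

open SimpleGraph (mulCayley)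

variable {G : Type*} [Group G] {S : Set G} {hS : Subgroup.closure S = ⊤} {δ : ℝ}

theorem IsPeriodicGeodesic.mono {Γ : SimpleGraph G} {M N : ℕ} {g : G} {c : ℤ → G} {ℓ : ℤ}
    (hc : IsPeriodicGeodesic Γ N g c ℓ) (h : M ≤ N) : IsPeriodicGeodesic Γ M g c ℓ :=
  { hc with isLocalGeodesic := hc.isLocalGeodesic.mono h }

theorem exists_hasClosings_of_isHyperbolic (hfin : S.Finite)
    (hδ : IsHyperbolic (CayleySpace S hS) δ)
    (hconcat : ConcatenationHypothesis (localGeodesics S hS (10 * δ))) :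
    ∃ N D, 8 * ⌊δ⌋₊ + 2 ≤ N ∧ HasClosings S hS N D := by
  rcases lt_or_ge δ (1 / 5) with hsmall | hlarge
  · have hfloor : ⌊δ⌋₊ = 0 := Nat.floor_eq_zero.2 (by linarith)
    exact ⟨2, 1, by omega, hasClosings_of_lt_half hδ (by linarith)⟩
  · have hδ₀ : 0 ≤ δ := by linarith
    obtain ⟨D, hD⟩ := exists_hasClosings hfin (by positivity : 0 ≤ 10 * δ) hconcat
    refine ⟨_, D, Nat.le_floor ?_, hD⟩
    push_cast
    rcases Nat.eq_zero_or_pos ⌊δ⌋₊ with hfloor | hfloor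
    · rw [hfloor]
      norm_num
      linarith
    · have hfloor' : (1 : ℝ) ≤ ⌊δ⌋₊ := mod_cast hfloor
      linarith [Nat.floor_le hδ₀]

theorem exists_dist_le_isPeriodicGeodesic [Infinite G] (hfin : S.Finite)
    (hδ : IsHyperbolic (CayleySpace S hS) δ)
    (hconcat : ConcatenationHypothesis (localGeodesics S hS (10 * δ))) :
    ∃ D : ℕ, ∀ g : G, ∃ g' c ℓ, (mulCayley S).dist g g' ≤ D ∧
      IsPeriodicGeodesic (mulCayley S) (8 * ⌊δ⌋₊ + 2) g' c ℓ := by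
  obtain ⟨N, D, hN, hD⟩ := exists_hasClosings_of_isHyperbolic hfin hδ hconcat
  obtain ⟨h, hh⟩ := ((boundedGeometry_mulCayley hS hfin).finite_ball 1 N).exists_notMem
  have hlong : N ≤ (mulCayley S).dist 1 h := (not_le.1 hh).le
  -- Elements that are too short to be closed up are first moved to the long element `h`.
  have hmove : ∀ g, ∃ a, N ≤ (mulCayley S).dist 1 a ∧
      (mulCayley S).dist g a ≤ N + (mulCayley S).dist 1 h := by
    intro g
    rcases le_total N ((mulCayley S).dist 1 g) with hg | hg
    · exact ⟨g, hg, by simp⟩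
    · refine ⟨h, hlong, (cayley_connected hS).dist_triangle.trans (Nat.add_le_add_right ?_ _)⟩
      rwa [SimpleGraph.dist_comm]
  refine ⟨N + (mulCayley S).dist 1 h + D, fun g => ?_⟩
  obtain ⟨a, ha, hga⟩ := hmove g
  obtain ⟨g', c, ℓ, hag', hc⟩ := hD.exists_isPeriodicGeodesic (by omega) ha
  exact ⟨g', c, ℓ, (cayley_connected hS).dist_triangle.trans (Nat.add_le_add hga hag'),
    hc.mono hN⟩

end Main

end CayleyHyp

end

theorem mainTheorem5_general {G : Type*} [Group G] [Infinite G] (S : Set G) (hfin : S.Finite)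
    (hS : Subgroup.closure S = ⊤) (δ : ℝ)
    (hδ : CayleyHyp.IsHyperbolic (CayleyHyp.CayleySpace S hS) δ)
    (hconcat : CayleyHyp.ConcatenationHypothesis (CayleyHyp.localGeodesics S hS (10 * δ))) :
    ∃ D : ℝ, ∀ g : G,
      ∃ g' : G, dist (CayleyHyp.cayleyVertex S hS g) (CayleyHyp.cayleyVertex S hS g') ≤ D ∧
        CayleyHyp.ActsLoxodromically (CayleyHyp.cayleyVertex S hS 1) g' ∧
        ¬ IsOfFinOrder g' ∧
        (∃ γ : ℝ → CayleyHyp.CayleySpace S hS,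
          CayleyHyp.IsAxis (CayleyHyp.cayleyVertex S hS 1) g' γ) ∧
        ∀ γ : ℝ → CayleyHyp.CayleySpace S hS,
          CayleyHyp.IsAxis (CayleyHyp.cayleyVertex S hS 1) g' γ →
            ∃ t : ℝ, dist (CayleyHyp.cayleyVertex S hS 1) (γ t) ≤ 4 * δ := by
  obtain ⟨D, hD⟩ := CayleyHyp.exists_dist_le_isPeriodicGeodesic hfin hδ hconcat
  refine ⟨D, fun g => ?_⟩
  obtain ⟨g', c, ℓ, hgg', hc⟩ := hD g
  have hlox := hc.actsLoxodromically hfin hδ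
  refine ⟨g', ?_, hlox, hlox.not_isOfFinOrder, hc.exists_isAxis hfin hδ,
    fun γ hγ => hc.exists_dist_axis_le hδ hγ⟩
  rw [CayleyHyp.dist_cayleyVertex]
  exact_mod_cast hgg'

theorem mainTheorem5 {G : Type*} [Group G] [Infinite G] (S : Set G) (hfin : S.Finite)
    (hS : Subgroup.closure S = ⊤) (δ : ℝ)
    (hδ : CayleyHyp.IsHyperbolic (CayleyHyp.CayleySpace S hS) δ)
    (hconcat : CayleyHyp.ConcatenationHypothesis (CayleyHyp.localGeodesics S hS (10 * δ))) :
    ∃ D R : ℝ, ∀ g : G,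
      10 * δ ≤ dist (CayleyHyp.cayleyVertex S hS 1) (CayleyHyp.cayleyVertex S hS g) →
      ∃ g' : G, dist (CayleyHyp.cayleyVertex S hS g) (CayleyHyp.cayleyVertex S hS g') ≤ D ∧
        CayleyHyp.ActsLoxodromically (CayleyHyp.cayleyVertex S hS 1) g' ∧
        ¬ IsOfFinOrder g' ∧
        (∃ γ : ℝ → CayleyHyp.CayleySpace S hS,
          CayleyHyp.IsAxis (CayleyHyp.cayleyVertex S hS 1) g' γ) ∧
        ∀ γ : ℝ → CayleyHyp.CayleySpace S hS,
          CayleyHyp.IsAxis (CayleyHyp.cayleyVertex S hS 1) g' γ →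
            ∃ t : ℝ, dist (CayleyHyp.cayleyVertex S hS 1) (γ t) ≤ R := by
  obtain ⟨D, hD⟩ := mainTheorem5_general S hfin hS δ hδ hconcat
  exact ⟨D, 4 * δ, fun g _ => hD g⟩
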